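/- Let $\mathbb{Z}$ be a real Hilbert space, let $\mathcal{A}$ generate a $C^0$ semigroup $e^{\mathcal{A}t}$ on $\mathbb{Z}$, let $\mathcal{B}:\mathbb{R}^{n_u}\to\mathbb{Z}$ and $\mathcal{C}:\mathbb{Z}\to\mathbb{R}^{n_y}$ be bounded linear operators (so that $\mathcal{B}^\ast$ is bounded), and let $R\in\mathbb{R}^{n_u\times n_u}$ be symmetric positive definite. Let $\Pi$ be a bounded, self-adjoint, nonnegative solution of the algebraic Riccati equation $$\langle z_2,\Pi\mathcal{A}z_1\rangle+\langle\mathcal{A}z_2,\Pi z_1\rangle+\langle\mathcal{C}z_1,\mathcal{C}z_2\rangle-\langle\Pi\mathcal{B}R^{-1}\mathcal{B}^\ast\Pi z_1,z_2\rangle=0,\qquad z_1,z_2\in\mathcal{D}(\mathcal{A}),$$ and put $\mathcal{K}=R^{-1}\mathcal{B}^\ast\Pi$, $\mathcal{A}_m=\mathcal{A}-\mathcal{B}\mathcal{K}$. Assume that there are a bounded self-adjoint coercive operator $\mathcal{P}$ on $\mathbb{Z}$ and $\lambda_P>0$ with $\langle\mathcal{A}_mz,\mathcal{P}z\rangle+\langle\mathcal{P}z,\mathcal{A}_mz\rangle\le-\lambda_P\langle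 z,\mathcal{P}z\rangle$ for all $z\in\mathcal{D}(\mathcal{A}_m)=\mathcal{D}(\mathcal{A})$. Then $\mathcal{A}_m$ generates an exponentially stable $C^0$ semigroup $e^{\mathcal{A}_mt}$, and, with $e^{\mathcal{A}_m^\ast t}=(e^{\mathcal{A}_mt})^\ast$, the integrals $$W_oz=\int_0^\infty e^{\mathcal{A}_m^\ast\tau}\mathcal{C}^\ast\mathcal{C}e^{\mathcal{A}_m\tau}z\,d\tau,\qquad(\mathcal{A}_m^\ast)^{-1}\mathcal{C}^\ast r=-\int_0^\infty e^{\mathcal{A}_m^\ast\tau}\mathcal{C}^\ast r\,d\tau$$ exist for all $z\in\mathbb{Z}$ and $r\in\mathbb{R}^{n_y}$. Moreover there are constants $M,\beta>0$ such that for every constant reference $r\in\mathbb{R}^{n_y}$ and every mild solution $v_p$ of $\dot v_p=\mathcal{A}_mv_p$ (the particular half with $f\equiv0$) the following hold. 1. (Static feedforward.) For $T>0$ let $q_T(t)=\int_T^te^{-\mathcal{A}_m^\ast(t-s)}\mathcal{C}^\ast(r-\mathcal{C}v_p(s))\,ds$, $0\le t\le T$, be the mild solution of $\dot q=-\mathcal{A}_m^\ast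 q+\mathcal{C}^\ast(r-\mathcal{C}v_p)$, $q(T)=0$. For every $t\ge0$, as $T\to\infty$, $q_T(t)$ converges to $q(t)=W_ov_p(t)+(\mathcal{A}_m^\ast)^{-1}\mathcal{C}^\ast r$. 2. (Control laws.) The SDAC law $u_{\rm trk}=-\mathcal{K}v_h-R^{-1}\mathcal{B}^\ast q$, as a function of the state $v=v_p+v_h$, converges exponentially fast to the classic linear quadratic tracking law $u_{\rm lqt}(v)=-\mathcal{K}v-R^{-1}\mathcal{B}^\ast(\mathcal{A}_m^\ast)^{-1}\mathcal{C}^\ast r$, uniformly in the state: for all $t\ge0$ and $z\in\mathbb{Z}$, with $v_h=z-v_p(t)$, one has $\|u_{\rm trk}-u_{\rm lqt}(z)\|\le Me^{-\beta t}\|v_p(0)\|$. For each fixed $z$ this difference belongs to $\mathcal{L}_\infty(\mathbb{R}^+,\mathbb{R}^{n_u})$ as a function of $t$. 3. (Control signals.) Let $v^\star$ be any mild solution of $\dot v^\star=\mathcal{A}v^\star+\mathcal{B}u_{\rm lqt}(v^\star)$. Let either (a) $v_h$ be any mild solution of $\dot v_h=\mathcal{A}v_h+\mathcal{B}u_{\rm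 trk}$ and $v=v_p+v_h$, or (b) $v$ be any mild solution of $\dot v=\mathcal{A}v+\mathcal{B}u_{\rm trk}$, with $v_h=v-v_p$ in $u_{\rm trk}$. In both cases the difference $u_{\rm trk}(t)-u_{\rm lqt}(v^\star(t))$ of the control signals is bounded, i.e. belongs to $\mathcal{L}_\infty(\mathbb{R}^+,\mathbb{R}^{n_u})$, and $\|u_{\rm trk}(t)-u_{\rm lqt}(v^\star(t))\|\le Me^{-\beta t}\left(\|v_p(0)\|+\|v(0)-v^\star(0)\|\right)$ for all $t\ge0$. -/

import Mathlib

open Set Filter Topology MeasureTheory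

namespace SDAC

noncomputable section

/-- `S` (restricted to `t ≥ 0`) is a strongly continuous semigroup of bounded operators.
The values of `S` at negative times carry no information and are never used. -/
structure IsC0Semigroup {Z : Type*} [NormedAddCommGroup Z] [InnerProductSpace ℝ Z]
    (S : ℝ → Z →L[ℝ] Z) : Prop where
  zero : S 0 = ContinuousLinearMap.id ℝ Z
  add : ∀ s t : ℝ, 0 ≤ s → 0 ≤ t → S (s + t) = (S s).comp (S t)
  cont : ∀ z : Z, ContinuousOn (fun t : ℝ => S t z) (Ici 0)

/-- `A` is the infinitesimal generator of the strongly continuous semigroup `S`: the graph of `A`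
consists exactly of the pairs `(z, y)` with `y = lim_{h ↓ 0} (S h z - z) / h`. -/
def Generates {Z : Type*} [NormedAddCommGroup Z] [InnerProductSpace ℝ Z]
    (A : Z →ₗ.[ℝ] Z) (S : ℝ → Z →L[ℝ] Z) : Prop :=
  IsC0Semigroup S ∧
    ∀ z y : Z, (z, y) ∈ A.graph ↔
      Tendsto (fun h : ℝ => h⁻¹ • (S h z - z)) (𝓝[>] 0) (𝓝 y)

/-- `‖S t‖ ≤ M e^{-β t}` for all `t ≥ 0`, with some `M, β > 0`. -/
def IsExpStable {Z : Type*} [NormedAddCommGroup Z] [InnerProductSpace ℝ Z]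
    (S : ℝ → Z →L[ℝ] Z) : Prop :=
  ∃ M β : ℝ, 0 < M ∧ 0 < β ∧ ∀ t : ℝ, 0 ≤ t → ‖S t‖ ≤ M * Real.exp (-β * t)

/-- `v` is a mild solution on `[0, ∞)` of `v' = A v + f(t, v)`, `v(0) = v₀`, where `A` generates
`S`. -/
def IsMildSolution {Z : Type*} [NormedAddCommGroup Z] [InnerProductSpace ℝ Z]
    (S : ℝ → Z →L[ℝ] Z) (f : ℝ → Z → Z) (v₀ : Z) (v : ℝ → Z) : Prop :=
  ContinuousOn v (Ici 0) ∧
    ∀ t : ℝ, 0 ≤ t → v t = S t v₀ + ∫ s in (0 : ℝ)..t, S (t - s) (f s (v s))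

/-- The adjoint semigroup `t ↦ (S t)*`. -/
def adjSemigroup {Z : Type*} [NormedAddCommGroup Z] [InnerProductSpace ℝ Z] [CompleteSpace Z]
    (S : ℝ → Z →L[ℝ] Z) : ℝ → Z →L[ℝ] Z :=
  fun t => ContinuousLinearMap.adjoint (S t)

/-- The inverse of the generator of `S`, as `z ↦ - ∫₀^∞ S(τ) z dτ`. -/
def generatorInv {Z : Type*} [NormedAddCommGroup Z] [InnerProductSpace ℝ Z]
    (S : ℝ → Z →L[ℝ] Z) (z : Z) : Z :=
  -∫ τ in Ioi (0 : ℝ), S τ z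

section Control

variable {Z : Type*} [NormedAddCommGroup Z] [InnerProductSpace ℝ Z] [CompleteSpace Z] {nu ny : ℕ}

/-- `R⁻¹ B* : Z → ℝ^{nu}`. -/
def RinvBadj (B : EuclideanSpace ℝ (Fin nu) →L[ℝ] Z) (R : Matrix (Fin nu) (Fin nu) ℝ) :
    Z →L[ℝ] EuclideanSpace ℝ (Fin nu) :=
  (Matrix.toEuclideanCLM (n := Fin nu) (𝕜 := ℝ) R⁻¹).comp (ContinuousLinearMap.adjoint B)

/-- The feedback gain `K = R⁻¹ B* X`. -/
def gain (B : EuclideanSpace ℝ (Fin nu) →L[ℝ] Z) (R : Matrix (Fin nu) (Fin nu) ℝ)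
    (X : Z →L[ℝ] Z) : Z →L[ℝ] EuclideanSpace ℝ (Fin nu) :=
  (RinvBadj B R).comp X

/-- The closed-loop operator `A - B K`, with domain `D(A)`. -/
def closedLoop (A : Z →ₗ.[ℝ] Z) (B : EuclideanSpace ℝ (Fin nu) →L[ℝ] Z)
    (K : Z →L[ℝ] EuclideanSpace ℝ (Fin nu)) : Z →ₗ.[ℝ] Z where
  domain := A.domain
  toFun := A.toFun - (B.comp K).toLinearMap.comp A.domain.subtype

/-- `X` is a bounded, self-adjoint, nonnegative solution of the algebraic Riccati equation
`A* X + X A + C* C - X B R⁻¹ B* X = 0` (in weak form on `D(A)`). -/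
def SolvesRiccati (A : Z →ₗ.[ℝ] Z) (B : EuclideanSpace ℝ (Fin nu) →L[ℝ] Z)
    (C : Z →L[ℝ] EuclideanSpace ℝ (Fin ny)) (R : Matrix (Fin nu) (Fin nu) ℝ)
    (X : Z →L[ℝ] Z) : Prop :=
  X.IsPositive ∧
    ∀ z₁ z₂ : A.domain,
      inner ℝ (z₂ : Z) (X (A z₁)) + inner ℝ (A z₂) (X (z₁ : Z))
        + inner ℝ (C (z₁ : Z)) (C (z₂ : Z))
        - inner ℝ (X (B (RinvBadj B R (X (z₁ : Z))))) (z₂ : Z) = 0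

/-- There are a bounded self-adjoint coercive operator `P` and `lam > 0` with
`⟨A z, P z⟩ + ⟨P z, A z⟩ ≤ -lam ⟨z, P z⟩` on `D(A)`. -/
def HasCoerciveLyapunov (A : Z →ₗ.[ℝ] Z) : Prop :=
  ∃ (P : Z →L[ℝ] Z) (lam c : ℝ), IsSelfAdjoint P ∧ 0 < lam ∧ 0 < c ∧
    (∀ z : Z, c * ‖z‖ ^ 2 ≤ inner ℝ z (P z)) ∧
    ∀ z : A.domain,
      inner ℝ (A z) (P (z : Z)) + inner ℝ (P (z : Z)) (A z) ≤ -lam * inner ℝ (z : Z) (P (z : Z))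

/-- The mild solution `q(t) = ∫_T^t e^{-A_m*(t-s)} C* σ(s) ds` (used for `t ≤ T`) of
`q' = -A_m* q + C* σ`, `q(T) = 0`, where `A_m` generates `Sm`. -/
def costate (Sm : ℝ → Z →L[ℝ] Z) (C : Z →L[ℝ] EuclideanSpace ℝ (Fin ny))
    (σ : ℝ → EuclideanSpace ℝ (Fin ny)) (T t : ℝ) : Z :=
  ∫ s in T..t, adjSemigroup Sm (s - t) (ContinuousLinearMap.adjoint C (σ s))

/-- The integrand `e^{A_m* τ} C* C e^{A_m τ} z` of the observability Gramian. -/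
def gramianIntegrand (Sm : ℝ → Z →L[ℝ] Z) (C : Z →L[ℝ] EuclideanSpace ℝ (Fin ny)) (z : Z)
    (τ : ℝ) : Z :=
  adjSemigroup Sm τ (ContinuousLinearMap.adjoint C (C (Sm τ z)))

/-- The observability Gramian `W_o z = ∫₀^∞ e^{A_m* τ} C* C e^{A_m τ} z dτ`. -/
def gramian (Sm : ℝ → Z →L[ℝ] Z) (C : Z →L[ℝ] EuclideanSpace ℝ (Fin ny)) (z : Z) : Z :=
  ∫ τ in Ioi (0 : ℝ), gramianIntegrand Sm C z τ

/-- `(A_m*)⁻¹ C* r`. -/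
def refTerm (Sm : ℝ → Z →L[ℝ] Z) (C : Z →L[ℝ] EuclideanSpace ℝ (Fin ny))
    (r : EuclideanSpace ℝ (Fin ny)) : Z :=
  generatorInv (adjSemigroup Sm) (ContinuousLinearMap.adjoint C r)

/-- The static feedforward `q = W_o v_p + (A_m*)⁻¹ C* r`. -/
def staticFeedforward (Sm : ℝ → Z →L[ℝ] Z) (C : Z →L[ℝ] EuclideanSpace ℝ (Fin ny))
    (r : EuclideanSpace ℝ (Fin ny)) (vp : Z) : Z :=
  gramian Sm C vp + refTerm Sm C r

/-- The SDAC law `u = -K v_h - R⁻¹ B* q`, with `q` the static feedforward. -/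
def sdacLaw (Sm : ℝ → Z →L[ℝ] Z) (B : EuclideanSpace ℝ (Fin nu) →L[ℝ] Z)
    (C : Z →L[ℝ] EuclideanSpace ℝ (Fin ny)) (R : Matrix (Fin nu) (Fin nu) ℝ) (X : Z →L[ℝ] Z)
    (r : EuclideanSpace ℝ (Fin ny)) (vp vh : Z) : EuclideanSpace ℝ (Fin nu) :=
  -gain B R X vh - RinvBadj B R (staticFeedforward Sm C r vp)

/-- The classic linear quadratic tracking law `u = -K v - R⁻¹ B* (A_m*)⁻¹ C* r`. -/
def lqtLaw (Sm : ℝ → Z →L[ℝ] Z) (B : EuclideanSpace ℝ (Fin nu) →L[ℝ] Z)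
    (C : Z →L[ℝ] EuclideanSpace ℝ (Fin ny)) (R : Matrix (Fin nu) (Fin nu) ℝ) (X : Z →L[ℝ] Z)
    (r : EuclideanSpace ℝ (Fin ny)) (v : Z) : EuclideanSpace ℝ (Fin nu) :=
  -gain B R X v - RinvBadj B R (refTerm Sm C r)

end Control

end

end SDAC

/-! The feedback is a bounded perturbation of the generator, so variation of constants produces the
closed-loop semigroup `Sm` as the fixed point of a Volterra equation, and shows that a mild solution
of `v' = A v + B (-K v + g)` is a mild solution of `v' = A_m v + B g`. Differentiating `⟨P v, v⟩`
along classical solutions turns the coercive Lyapunov inequality into `‖Sm t‖ ≤ M e^{-β t}`.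

Since `v_p (t + τ) = Sm τ (v_p t)`, the substitution `τ = s - t` writes the costate as an integral
over `[0, T - t]` of an integrable function of `τ`, whose limit is the static feedforward
`W_o v_p + (A_m*)⁻¹ C* r`. Hence the two laws differ, at states `v` and `v⋆`, by `-K (v - v⋆)` plus
a bounded operator applied to `v_p`. At equal states this decays like `v_p`; along trajectories
the error `v - v⋆` solves the closed-loop equation driven by the decaying `v_p`, and the convolution
of two exponentials of equal rate decays at any smaller rate. -/

namespace SDAC

section StronglyContinuous

variable {E F : Type*} [NormedAddCommGroup E] [NormedSpace ℝ E] [CompleteSpace E]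
  [NormedAddCommGroup F] [NormedSpace ℝ F] {S : ℝ → E →L[ℝ] F} {f : ℝ → E}

theorem exists_norm_le_of_continuousOn (hS : ∀ z, ContinuousOn (fun t => S t z) (Ici 0)) (T : ℝ) :
    ∃ M : ℝ, 0 < M ∧ ∀ t ∈ Icc 0 T, ‖S t‖ ≤ M := by
  obtain ⟨C, hC⟩ := banach_steinhaus (g := fun t : Icc (0 : ℝ) T => S t) fun z => by
    obtain ⟨C, hC⟩ := isCompact_Icc.exists_bound_of_continuousOn
      ((hS z).mono (t := Icc 0 T) Icc_subset_Ici_self)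
    exact ⟨C, fun t => hC t t.2⟩
  exact ⟨max C 1, by positivity, fun t ht => (hC ⟨t, ht⟩).trans (le_max_left _ _)⟩

theorem continuousOn_uncurry_apply (hS : ∀ z, ContinuousOn (fun t => S t z) (Ici 0)) :
    ContinuousOn (fun p : ℝ × E => S p.1 p.2) (Ici 0 ×ˢ univ) := by
  rintro ⟨t, z⟩ ht
  obtain ⟨M, hM0, hM⟩ := exists_norm_le_of_continuousOn hS (t + 1)
  have hcont : ContinuousOn (fun p : ℝ × E => S p.1 p.2) (Icc 0 (t + 1) ×ˢ univ) :=
    continuousOn_prod_of_continuousOn_lipschitzOnWith' _ ⟨M, hM0.le⟩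
      (fun s hs => ((S s).lipschitz.weaken (hM s hs)).lipschitzOnWith)
      fun z _ => (hS z).mono Icc_subset_Ici_self
  refine (hcont (t, z) ⟨⟨ht.1, by simp⟩, mem_univ _⟩).mono_of_mem_nhdsWithin ?_
  rw [nhdsWithin_prod_eq]
  refine prod_mem_prod ?_ self_mem_nhdsWithin
  exact Ici_inter_Iic (a := (0 : ℝ)) (b := t + 1) ▸
    inter_mem_nhdsWithin _ (Iic_mem_nhds (lt_add_one t))

theorem continuousOn_comp_apply (hS : ∀ z, ContinuousOn (fun t => S t z) (Ici 0))
    {Y : Type*} [TopologicalSpace Y] {s : Set Y} {a : Y → ℝ} {g : Y → E}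
    (ha : ContinuousOn a s) (ha0 : ∀ y ∈ s, 0 ≤ a y) (hg : ContinuousOn g s) :
    ContinuousOn (fun y => S (a y) (g y)) s :=
  (continuousOn_uncurry_apply hS).comp (ha.prodMk hg) fun y hy => ⟨ha0 y hy, mem_univ _⟩

theorem tendsto_apply (hS : ∀ z, ContinuousOn (fun t => S t z) (Ici 0)) {Y : Type*}
    {l : Filter Y} {a : Y → ℝ} {g : Y → E} {t : ℝ} {z : E} (ht : 0 ≤ t) (ha : Tendsto a l (𝓝 t))
    (ha0 : ∀ᶠ y in l, 0 ≤ a y) (hg : Tendsto g l (𝓝 z)) :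
    Tendsto (fun y => S (a y) (g y)) l (𝓝 (S t z)) :=
  (continuousOn_uncurry_apply hS (t, z) ⟨ht, mem_univ _⟩).tendsto.comp
    (tendsto_nhdsWithin_iff.2 ⟨ha.prodMk_nhds hg, ha0.mono fun _ hy => ⟨hy, mem_univ _⟩⟩)

theorem continuousOn_apply_sub (hS : ∀ z, ContinuousOn (fun t => S t z) (Ici 0))
    (hf : ContinuousOn f (Ici 0)) (t : ℝ) :
    ContinuousOn (fun s => S (t - s) (f s)) (Icc 0 t) :=
  continuousOn_comp_apply hS (by fun_prop) (fun _ hs => sub_nonneg.2 hs.2)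
    (hf.mono Icc_subset_Ici_self)

theorem intervalIntegrable_apply_sub (hS : ∀ z, ContinuousOn (fun t => S t z) (Ici 0))
    (hf : ContinuousOn f (Ici 0)) {a b t : ℝ} (ha : 0 ≤ a) (hab : a ≤ b) (hb : b ≤ t) :
    IntervalIntegrable (fun s => S (t - s) (f s)) volume a b := by
  refine ContinuousOn.intervalIntegrable ((continuousOn_apply_sub hS hf t).mono ?_)
  rw [uIcc_of_le hab]
  exact Icc_subset_Icc ha hb

theorem continuousOn_convolution (hS : ∀ z, ContinuousOn (fun t => S t z) (Ici 0))
    (hf : ContinuousOn f (Ici 0)) :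
    ContinuousOn (fun t => ∫ s in (0 : ℝ)..t, S (t - s) (f s)) (Ici 0) := by
  have hjoint : Continuous (fun p : ℝ × ℝ => S (max (p.1 - p.2) 0) (f (max p.2 0))) := by
    rw [← continuousOn_univ]
    refine continuousOn_comp_apply hS (by fun_prop) (fun _ _ => le_max_right _ _) ?_
    exact hf.comp (by fun_prop) (fun _ _ => mem_Ici.2 (le_max_right _ _))
  have hintegral := intervalIntegral.continuous_parametric_intervalIntegral_of_continuous
    (a₀ := (0 : ℝ)) (f := fun t s => S (max (t - s) 0) (f (max s 0))) (μ := volume) hjoint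
    continuous_id
  refine hintegral.continuousOn.congr fun t (ht : 0 ≤ t) => ?_
  refine intervalIntegral.integral_congr fun s hs => ?_
  rw [uIcc_of_le ht] at hs
  simp only [max_eq_left hs.1, max_eq_left (sub_nonneg.2 hs.2)]

theorem tendsto_mean_of_continuousOn [CompleteSpace F] {g : ℝ → ℝ → F}
    (hg : ContinuousOn (fun p : ℝ × ℝ => g p.1 p.2) {p | 0 ≤ p.2 ∧ p.2 ≤ p.1}) :
    Tendsto (fun h : ℝ => h⁻¹ • ∫ s in (0 : ℝ)..h, g h s) (𝓝[>] 0) (𝓝 (g 0 0)) := by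
  rw [Metric.tendsto_nhds]
  intro ε hε
  obtain ⟨δ, hδ, hgδ⟩ :=
    Metric.continuousWithinAt_iff.1 (hg (0, 0) (by simp)) (ε / 2) (by positivity)
  filter_upwards [Ioo_mem_nhdsGT hδ] with h ⟨h0, hh⟩
  have hint : IntervalIntegrable (fun s => g h s) volume 0 h := by
    refine ContinuousOn.intervalIntegrable ?_
    rw [uIcc_of_le h0.le]
    exact hg.comp (f := fun s : ℝ => (h, s)) (by fun_prop) fun s hs => ⟨hs.1, hs.2⟩
  have hmean : h⁻¹ • (∫ s in (0 : ℝ)..h, g h s) - g 0 0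
      = h⁻¹ • ∫ s in (0 : ℝ)..h, (g h s - g 0 0) := by
    rw [intervalIntegral.integral_sub hint (by simp), intervalIntegral.integral_const, sub_zero,
      smul_sub, smul_smul, inv_mul_cancel₀ h0.ne', one_smul]
  have hbound : ‖∫ s in (0 : ℝ)..h, (g h s - g 0 0)‖ ≤ ε / 2 * |h - 0| := by
    refine intervalIntegral.norm_integral_le_of_norm_le_const fun s hs => ?_
    rw [uIoc_of_le h0.le] at hs
    rw [← dist_eq_norm]
    refine (hgδ (x := (h, s)) ⟨hs.1.le, hs.2⟩ ?_).le
    rw [Prod.dist_eq, max_lt_iff, Real.dist_0_eq_abs, Real.dist_0_eq_abs, abs_of_pos h0,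
      abs_of_pos hs.1]
    exact ⟨hh, hs.2.trans_lt hh⟩
  rw [sub_zero, abs_of_pos h0] at hbound
  rw [dist_eq_norm, hmean, norm_smul, norm_inv, Real.norm_of_nonneg h0.le]
  calc h⁻¹ * ‖∫ s in (0 : ℝ)..h, (g h s - g 0 0)‖ ≤ h⁻¹ * (ε / 2 * h) := by gcongr
    _ = ε / 2 := by field_simp
    _ < ε := half_lt_self hε

theorem tendsto_mean_convolution [CompleteSpace F]
    (hS : ∀ z, ContinuousOn (fun t => S t z) (Ici 0)) (hf : ContinuousOn f (Ici 0)) :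
    Tendsto (fun h : ℝ => h⁻¹ • ∫ s in (0 : ℝ)..h, S (h - s) (f s)) (𝓝[>] 0)
      (𝓝 (S 0 (f 0))) := by
  have h := tendsto_mean_of_continuousOn (g := fun h s => S (h - s) (f s))
    (continuousOn_comp_apply hS (by fun_prop) (fun p hp => sub_nonneg.2 hp.2)
      (hf.comp (by fun_prop) fun p hp => hp.1))
  simpa only [sub_zero] using h

theorem tendsto_mean (hf : ContinuousOn f (Ici 0)) :
    Tendsto (fun h : ℝ => h⁻¹ • ∫ s in (0 : ℝ)..h, f s) (𝓝[>] 0) (𝓝 (f 0)) :=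
  tendsto_mean_convolution (S := fun _ => ContinuousLinearMap.id ℝ E)
    (fun _ => continuousOn_const) hf

end StronglyContinuous

section Semigroup

variable {Z : Type*} [NormedAddCommGroup Z] [InnerProductSpace ℝ Z] {S : ℝ → Z →L[ℝ] Z}

theorem IsC0Semigroup.add_apply (hS : IsC0Semigroup S) {s t : ℝ} (hs : 0 ≤ s) (ht : 0 ≤ t)
    (z : Z) : S (s + t) z = S s (S t z) := by
  rw [hS.add s t hs ht, ContinuousLinearMap.comp_apply]

theorem IsC0Semigroup.natCast (hS : IsC0Semigroup S) (n : ℕ) : S n = S 1 ^ n := by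
  induction n with
  | zero => rw [Nat.cast_zero, pow_zero, hS.zero, ContinuousLinearMap.one_def]
  | succ n ih =>
    rw [Nat.cast_succ, hS.add _ _ n.cast_nonneg zero_le_one, ih, pow_succ,
      ContinuousLinearMap.mul_def]

theorem IsC0Semigroup.exists_norm_le_exp [CompleteSpace Z] (hS : IsC0Semigroup S) :
    ∃ M ω : ℝ, 0 < M ∧ ∀ t, 0 ≤ t → ‖S t‖ ≤ M * Real.exp (ω * t) := by
  obtain ⟨M, hM1, hM⟩ : ∃ M : ℝ, 1 ≤ M ∧ ∀ t ∈ Icc (0 : ℝ) 1, ‖S t‖ ≤ M :=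
    let ⟨M, _, hM⟩ := exists_norm_le_of_continuousOn hS.cont 1
    ⟨max M 1, le_max_right _ _, fun t ht => (hM t ht).trans (le_max_left _ _)⟩
  have hM0 : 0 < M := one_pos.trans_le hM1
  refine ⟨M, Real.log M, hM0, fun t ht => ?_⟩
  have hsplit : S t = (S (Int.fract t)).comp (S 1 ^ ⌊t⌋₊) := by
    rw [← hS.natCast, ← hS.add _ _ (Int.fract_nonneg t) (Nat.cast_nonneg _),
      natCast_floor_eq_intCast_floor ht, Int.fract_add_floor]
  calc ‖S t‖ ≤ ‖S (Int.fract t)‖ * ‖S 1 ^ ⌊t⌋₊‖ :=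
        hsplit ▸ ContinuousLinearMap.opNorm_comp_le _ _
    _ ≤ M * M ^ ⌊t⌋₊ := by
        gcongr
        · exact hM _ ⟨Int.fract_nonneg t, (Int.fract_lt_one t).le⟩
        · rcases Nat.eq_zero_or_pos ⌊t⌋₊ with h | h
          · rw [h, pow_zero, pow_zero]
            exact ContinuousLinearMap.norm_id_le
          · exact (norm_pow_le' _ h).trans (by gcongr; exact hM 1 (by simp))
    _ ≤ M * Real.exp (Real.log M * t) := by
        rw [← Real.rpow_natCast, Real.rpow_def_of_pos hM0]
        gcongr
        · exact Real.log_nonneg hM1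
        · exact Nat.floor_le ht

end Semigroup

theorem eq_zero_of_norm_le_mul_integral {E : Type*} [NormedAddCommGroup E] {u : ℝ → E}
    {K T : ℝ} (hK : 0 ≤ K)
    (hu : ContinuousOn u (Ici 0)) (huK : ∀ t ∈ Icc 0 T, ‖u t‖ ≤ K * ∫ s in (0 : ℝ)..t, ‖u s‖) :
    ∀ t ∈ Icc 0 T, u t = 0 := by
  have hint : ∀ t, 0 ≤ t → IntervalIntegrable (fun s => ‖u s‖) volume 0 t := fun t ht =>
    (hu.norm.mono (by rw [uIcc_of_le ht]; exact Icc_subset_Ici_self)).intervalIntegrable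
  have hderiv : ∀ t, 0 ≤ t →
      HasDerivWithinAt (fun x => ∫ s in (0 : ℝ)..x, ‖u s‖) ‖u t‖ (Ici t) t := fun t ht =>
    have hut : ContinuousOn (fun s => ‖u s‖) (Ici t) := hu.norm.mono (Ici_subset_Ici.2 ht)
    intervalIntegral.integral_hasDerivWithinAt_right (hint t ht)
      ((hut.mono Ioi_subset_Ici_self).stronglyMeasurableAtFilter_nhdsWithin measurableSet_Ioi t)
      ((hut t self_mem_Ici).mono Ioi_subset_Ici_self)
  have hzero := eq_zero_of_abs_deriv_le_mul_abs_self_of_eq_zero_right (K := K)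
    (continuousOn_convolution (S := fun _ => ContinuousLinearMap.id ℝ ℝ)
      (fun _ => continuousOn_const) hu.norm |>.mono Icc_subset_Ici_self)
    (fun t ht => hderiv t ht.1) intervalIntegral.integral_same fun t ht => by
      rw [norm_norm]
      exact (huK t (Ico_subset_Icc_self ht)).trans
        (mul_le_mul_of_nonneg_left (Real.le_norm_self _) hK)
  intro t ht
  have hnorm : ∫ s in (0 : ℝ)..t, ‖u s‖ = 0 := hzero t ht
  simpa only [hnorm, mul_zero, norm_le_zero_iff] using huK t ht

section MildSolution

variable {Z : Type*} [NormedAddCommGroup Z] [InnerProductSpace ℝ Z] {S : ℝ → Z →L[ℝ] Z}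
  {f g : ℝ → Z → Z} {v₀ w₀ : Z} {v w : ℝ → Z}

theorem IsMildSolution.congr (hv : IsMildSolution S f v₀ v)
    (hfg : ∀ s, 0 ≤ s → f s (v s) = g s (v s)) : IsMildSolution S g v₀ v := by
  refine ⟨hv.1, fun t ht => (hv.2 t ht).trans ?_⟩
  congr 1
  refine intervalIntegral.integral_congr fun s hs => ?_
  rw [uIcc_of_le ht] at hs
  simp only [hfg s hs.1]

theorem IsMildSolution.apply_zero (hv : IsMildSolution S f v₀ v) (hS : IsC0Semigroup S) :
    v 0 = v₀ := by
  simpa [hS.zero] using hv.2 0 le_rfl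

theorem isMildSolution_zero_iff :
    IsMildSolution S (fun _ _ => 0) v₀ v ↔ ContinuousOn v (Ici 0) ∧ ∀ t, 0 ≤ t → v t = S t v₀ := by
  simp only [IsMildSolution, map_zero, intervalIntegral.integral_zero, add_zero]

variable [CompleteSpace Z]

theorem IsMildSolution.sub (hv : IsMildSolution S f v₀ v) (hw : IsMildSolution S g w₀ w)
    (hS : ∀ z, ContinuousOn (fun t => S t z) (Ici 0))
    (hf : ContinuousOn (fun s => f s (v s)) (Ici 0))
    (hg : ContinuousOn (fun s => g s (w s)) (Ici 0)) :
    IsMildSolution S (fun s _ => f s (v s) - g s (w s)) (v₀ - w₀) (fun t => v t - w t) := by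
  refine ⟨hv.1.sub hw.1, fun t ht => ?_⟩
  simp only [map_sub]
  rw [intervalIntegral.integral_sub (intervalIntegrable_apply_sub hS hf le_rfl ht le_rfl)
    (intervalIntegrable_apply_sub hS hg le_rfl ht le_rfl), hv.2 t ht, hw.2 t ht]
  abel

theorem IsMildSolution.shift (hv : IsMildSolution S f v₀ v) (hS : IsC0Semigroup S)
    (hf : ContinuousOn (fun s => f s (v s)) (Ici 0)) {t : ℝ} (ht : 0 ≤ t) :
    IsMildSolution S (fun s => f (t + s)) (v t) (fun s => v (t + s)) := by
  refine ⟨hv.1.comp (by fun_prop) fun s hs => add_nonneg ht hs, fun h hh => ?_⟩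
  have hpast : ∫ s in (0 : ℝ)..t, S (t + h - s) (f s (v s))
      = S h (∫ s in (0 : ℝ)..t, S (t - s) (f s (v s))) := by
    rw [← ContinuousLinearMap.intervalIntegral_comp_comm _
      (intervalIntegrable_apply_sub hS.cont hf le_rfl ht le_rfl)]
    refine intervalIntegral.integral_congr fun s hs => ?_
    rw [uIcc_of_le ht] at hs
    simp only [← hS.add_apply hh (sub_nonneg.2 hs.2), add_comm t h, add_sub_assoc]
  have hfuture : ∫ s in t..(t + h), S (t + h - s) (f s (v s))
      = ∫ s in (0 : ℝ)..h, S (h - s) (f (t + s) (v (t + s))) := by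
    simpa only [add_zero, add_sub_add_left_eq_sub] using
      (intervalIntegral.integral_comp_add_left (a := 0) (b := h)
        (fun s => S (t + h - s) (f s (v s))) t).symm
  beta_reduce
  rw [hv.2 _ (add_nonneg ht hh), ← intervalIntegral.integral_add_adjacent_intervals
      (intervalIntegrable_apply_sub hS.cont hf le_rfl ht (le_add_of_nonneg_right hh))
      (intervalIntegrable_apply_sub hS.cont hf ht (le_add_of_nonneg_right hh) le_rfl),
    hpast, hfuture, hv.2 t ht, map_add, add_comm t h, hS.add_apply hh ht, add_assoc]

theorem IsMildSolution.tendsto_quotient (hv : IsMildSolution S f v₀ v) (hS : IsC0Semigroup S)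
    (hf : ContinuousOn (fun s => f s (v s)) (Ici 0)) :
    Tendsto (fun h : ℝ => h⁻¹ • (v h - S h v₀)) (𝓝[>] 0) (𝓝 (f 0 v₀)) := by
  have hmean := tendsto_mean_convolution hS.cont hf
  rw [hS.zero, ContinuousLinearMap.id_apply, hv.apply_zero hS] at hmean
  refine hmean.congr' ?_
  filter_upwards [self_mem_nhdsWithin] with h (hh : 0 < h)
  rw [hv.2 h hh.le, add_sub_cancel_left]

theorem IsMildSolution.eq_zero {D : Z →L[ℝ] Z} (hv : IsMildSolution S (fun _ x => D x) 0 v)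
    (hS : ∀ z, ContinuousOn (fun t => S t z) (Ici 0)) {t : ℝ} (ht : 0 ≤ t) : v t = 0 := by
  obtain ⟨M, hM0, hM⟩ := exists_norm_le_of_continuousOn hS t
  refine eq_zero_of_norm_le_mul_integral (K := M * ‖D‖) (by positivity) hv.1 (fun x hx => ?_) t
    ⟨ht, le_rfl⟩
  rw [hv.2 x hx.1, map_zero, zero_add, ← intervalIntegral.integral_const_mul]
  refine intervalIntegral.norm_integral_le_of_norm_le hx.1 (ae_of_all _ fun s hs => ?_) ?_
  · rw [mul_assoc]
    exact (S (x - s)).le_of_opNorm_le_of_le (hM _ ⟨sub_nonneg.2 hs.2, by linarith [hs.1, hx.2]⟩)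
      (D.le_opNorm _)
  · refine ((hv.1.norm.mono ?_).const_mul _).intervalIntegrable
    rw [uIcc_of_le hx.1]
    exact Icc_subset_Ici_self

end MildSolution

open scoped BoundedContinuousFunction

section Volterra

variable {E F : Type*} [NormedAddCommGroup E] [NormedSpace ℝ E]
  [NormedAddCommGroup F] [NormedSpace ℝ F] {U : ℝ → E →L[ℝ] F}

theorem integral_exp_neg_mul_sub_le {a : ℝ} (ha : 0 < a) (t : ℝ) :
    ∫ s in (0 : ℝ)..t, Real.exp (-a * (t - s)) ≤ 1 / a := by
  have hderiv : ∀ s ∈ uIcc 0 t, HasDerivAt (fun s => Real.exp (-a * (t - s)) / a)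
      (Real.exp (-a * (t - s))) s := fun s _ => by
    have hlin : HasDerivAt (fun s => -a * (t - s)) a s := by
      simpa using ((hasDerivAt_id s).const_sub t).const_mul (-a)
    simpa [ha.ne'] using hlin.exp.div_const a
  rw [intervalIntegral.integral_eq_sub_of_hasDerivAt hderiv
    (Continuous.intervalIntegrable (by fun_prop) _ _)]
  have : 0 ≤ Real.exp (-a * (t - 0)) / a := by positivity
  simpa using this

theorem norm_convolution_le {N a : ℝ} (ha : 0 < a)
    (hN : ∀ t, 0 ≤ t → ‖U t‖ ≤ N * Real.exp (-a * t)) (w : ℝ →ᵇ E) {t : ℝ} (ht : 0 ≤ t) :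
    ‖∫ s in (0 : ℝ)..t, U (t - s) (w s)‖ ≤ N / a * ‖w‖ := by
  have hN0 : 0 ≤ N := by simpa using (norm_nonneg _).trans (hN 0 le_rfl)
  calc ‖∫ s in (0 : ℝ)..t, U (t - s) (w s)‖
      ≤ ∫ s in (0 : ℝ)..t, N * ‖w‖ * Real.exp (-a * (t - s)) := by
        refine intervalIntegral.norm_integral_le_of_norm_le ht (ae_of_all _ fun s hs => ?_)
          (Continuous.intervalIntegrable (by fun_prop) _ _)
        rw [mul_right_comm]
        exact (U (t - s)).le_of_opNorm_le_of_le (hN _ (sub_nonneg.2 hs.2)) (w.norm_coe_le_norm s)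
    _ ≤ N * ‖w‖ * (1 / a) := by
        rw [intervalIntegral.integral_const_mul]
        gcongr
        exact integral_exp_neg_mul_sub_le ha t
    _ = N / a * ‖w‖ := by ring

/-- The orbit map `z ↦ (t ↦ U t z)` of a bounded strongly continuous family, with values in the
bounded continuous functions. Orbits are extended by their value at `0` to negative times. -/
noncomputable def orbitCLM (hU : ∀ z, ContinuousOn (fun t => U t z) (Ici 0)) {M : ℝ}
    (hM : ∀ t, 0 ≤ t → ‖U t‖ ≤ M) : E →L[ℝ] (ℝ →ᵇ F) :=
  have hbound : ∀ z t, ‖U (max t 0) z‖ ≤ M * ‖z‖ := fun _ _ =>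
    (U _).le_of_opNorm_le (hM _ (le_max_right _ _)) _
  LinearMap.mkContinuous
    { toFun := fun z => BoundedContinuousFunction.ofNormedAddCommGroup (fun t => U (max t 0) z)
        ((hU z).comp_continuous (by fun_prop) fun _ => mem_Ici.2 (le_max_right _ _)) (M * ‖z‖)
        (hbound z)
      map_add' := fun x y => by ext t; simp
      map_smul' := fun c x => by ext t; simp } M
    fun z => (BoundedContinuousFunction.norm_le
      (mul_nonneg ((norm_nonneg _).trans (hM 0 le_rfl)) (norm_nonneg z))).2 (hbound z)

theorem orbitCLM_apply (hU : ∀ z, ContinuousOn (fun t => U t z) (Ici 0)) {M : ℝ}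
    (hM : ∀ t, 0 ≤ t → ‖U t‖ ≤ M) {t : ℝ} (ht : 0 ≤ t) (z : E) :
    orbitCLM hU hM z t = U t z :=
  show U (max t 0) z = U t z by rw [max_eq_left ht]

variable [CompleteSpace E]

/-- The Volterra operator `w ↦ (t ↦ ∫₀ᵗ U (t - s) (w s) ds)` on bounded continuous functions, for an
exponentially decaying strongly continuous family `U`. As in `orbitCLM`, the values at negative
times are those at `0`. -/
noncomputable def convolutionCLM (hU : ∀ z, ContinuousOn (fun t => U t z) (Ici 0)) {N a : ℝ}
    (ha : 0 < a) (hN : ∀ t, 0 ≤ t → ‖U t‖ ≤ N * Real.exp (-a * t)) :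
    (ℝ →ᵇ E) →L[ℝ] (ℝ →ᵇ F) :=
  have hint : ∀ (w : ℝ →ᵇ E) (t : ℝ),
      IntervalIntegrable (fun s => U (max t 0 - s) (w s)) volume 0 (max t 0) := fun w t =>
    intervalIntegrable_apply_sub hU w.continuous.continuousOn le_rfl (le_max_right _ _) le_rfl
  LinearMap.mkContinuous
    { toFun := fun w => BoundedContinuousFunction.ofNormedAddCommGroup
        (fun t => ∫ s in (0 : ℝ)..(max t 0), U (max t 0 - s) (w s))
        ((continuousOn_convolution hU w.continuous.continuousOn).comp_continuous
          (f := fun t => max t 0) (by fun_prop) fun _ => mem_Ici.2 (le_max_right _ _))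
        (N / a * ‖w‖) fun _ => norm_convolution_le ha hN w (le_max_right _ _)
      map_add' := fun x y => by ext t; simp [intervalIntegral.integral_add (hint x t) (hint y t)]
      map_smul' := fun c x => by ext t; simp } (N / a)
    fun w => (BoundedContinuousFunction.norm_le ((norm_nonneg _).trans
      (norm_convolution_le ha hN w le_rfl))).2 fun _ =>
        norm_convolution_le ha hN w (le_max_right _ _)

theorem convolutionCLM_apply (hU : ∀ z, ContinuousOn (fun t => U t z) (Ici 0)) {N a : ℝ}
    (ha : 0 < a) (hN : ∀ t, 0 ≤ t → ‖U t‖ ≤ N * Real.exp (-a * t)) (w : ℝ →ᵇ E) {t : ℝ}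
    (ht : 0 ≤ t) : convolutionCLM hU ha hN w t = ∫ s in (0 : ℝ)..t, U (t - s) (w s) :=
  show ∫ s in (0 : ℝ)..(max t 0), U (max t 0 - s) (w s) = _ by rw [max_eq_left ht]

theorem norm_convolutionCLM_le (hU : ∀ z, ContinuousOn (fun t => U t z) (Ici 0)) {N a : ℝ}
    (ha : 0 < a) (hN : ∀ t, 0 ≤ t → ‖U t‖ ≤ N * Real.exp (-a * t)) :
    ‖convolutionCLM hU ha hN‖ ≤ N / a := by
  have hN0 : 0 ≤ N := by simpa using (norm_nonneg _).trans (hN 0 le_rfl)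
  exact ContinuousLinearMap.opNorm_le_bound _ (by positivity) fun w =>
    (BoundedContinuousFunction.norm_le (by positivity)).2 fun _ =>
      norm_convolution_le ha hN w (le_max_right _ _)

end Volterra

theorem exists_volterra_solution {E F : Type*} [NormedAddCommGroup E] [NormedSpace ℝ E]
    [NormedAddCommGroup F] [NormedSpace ℝ F] [CompleteSpace F] {U : ℝ → E →L[ℝ] F}
    (hU : ∀ z, ContinuousOn (fun t => U t z) (Ici 0)) {M : ℝ} (hM : ∀ t, 0 ≤ t → ‖U t‖ ≤ M)
    {W : ℝ → F →L[ℝ] F} (hW : ∀ z, ContinuousOn (fun t => W t z) (Ici 0)) {N a : ℝ}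
    (hN : ∀ t, 0 ≤ t → ‖W t‖ ≤ N * Real.exp (-a * t)) (hNa : N < a) :
    ∃ V : ℝ → E →L[ℝ] F, (∀ z, ContinuousOn (fun t => V t z) (Ici 0)) ∧
      ∀ t, 0 ≤ t → ∀ z, V t z = U t z + ∫ s in (0 : ℝ)..t, W (t - s) (V s z) := by
  have ha : 0 < a := lt_of_le_of_lt (by simpa using (norm_nonneg _).trans (hN 0 le_rfl)) hNa
  let T := convolutionCLM hW ha hN
  have hT : ‖T‖ < 1 := (norm_convolutionCLM_le hW ha hN).trans_lt ((div_lt_one ha).2 hNa)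
  let J : (ℝ →ᵇ F) →L[ℝ] (ℝ →ᵇ F) := ((Units.oneSub T hT)⁻¹).val
  have hJ : ∀ w, J w = w + T (J w) := fun w => by
    have hinv : (1 - T) * J = 1 := (Units.oneSub T hT).mul_inv
    exact sub_eq_iff_eq_add.1 (congrArg (fun L => L w) hinv)
  refine ⟨fun t => (BoundedContinuousFunction.evalCLM ℝ t).comp (J.comp (orbitCLM hU hM)),
    fun z => (J (orbitCLM hU hM z)).continuous.continuousOn, fun t ht z => ?_⟩
  calc J (orbitCLM hU hM z) t = orbitCLM hU hM z t + T (J (orbitCLM hU hM z)) t :=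
        congrArg (fun w : ℝ →ᵇ F => w t) (hJ _)
    _ = _ := by rw [orbitCLM_apply hU hM ht, convolutionCLM_apply hW ha hN _ ht]; rfl

theorem hasDerivWithinAt_Ioi_iff_tendsto {F : Type*} [NormedAddCommGroup F] [NormedSpace ℝ F]
    {f : ℝ → F} {f' : F} {t : ℝ} :
    HasDerivWithinAt f f' (Ioi t) t ↔
      Tendsto (fun h : ℝ => h⁻¹ • (f (t + h) - f t)) (𝓝[>] 0) (𝓝 f') := by
  have hmap : map (t + ·) (𝓝[>] 0) = 𝓝[>] t := by rw [map_add_left_nhdsGT, add_zero]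
  rw [hasDerivWithinAt_iff_tendsto_slope' self_notMem_Ioi, ← hmap, tendsto_map'_iff]
  simp only [Function.comp_def, slope, add_sub_cancel_left, vsub_eq_sub]

theorem closedLoop_eq_vadd {Z : Type*} [NormedAddCommGroup Z] [InnerProductSpace ℝ Z] {nu : ℕ}
    (A : Z →ₗ.[ℝ] Z) (B : EuclideanSpace ℝ (Fin nu) →L[ℝ] Z)
    (K : Z →L[ℝ] EuclideanSpace ℝ (Fin nu)) :
    closedLoop A B K = ((-(B.comp K) : Z →L[ℝ] Z) : Z →ₗ[ℝ] Z) +ᵥ A :=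
  LinearPMap.ext rfl fun x hx _ => sub_eq_neg_add (A ⟨x, hx⟩) (B (K x))

/-- `V` is the semigroup of the loop closed by `u = -K x`, in the sense of mild solutions: where `A`
generates `S`, a mild solution of `x' = A x + (g - B K x)` is one of `x' = (A - B K) x + g`, which
is governed by `V`. -/
def IsFeedbackSemigroup {Z : Type*} [NormedAddCommGroup Z] [InnerProductSpace ℝ Z] {nu : ℕ}
    (S V : ℝ → Z →L[ℝ] Z) (B : EuclideanSpace ℝ (Fin nu) →L[ℝ] Z)
    (K : Z →L[ℝ] EuclideanSpace ℝ (Fin nu)) : Prop :=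
  ∀ ⦃g e : ℝ → Z⦄ ⦃e₀ : Z⦄, ContinuousOn g (Ici 0) →
    IsMildSolution S (fun s x => g s - B (K x)) e₀ e → IsMildSolution V (fun s _ => g s) e₀ e

section Perturbation

variable {Z : Type*} [NormedAddCommGroup Z] [InnerProductSpace ℝ Z] [CompleteSpace Z]
  {S V : ℝ → Z →L[ℝ] Z} {D : Z →L[ℝ] Z}

theorem IsC0Semigroup.exists_perturbation (hS : IsC0Semigroup S) (D : Z →L[ℝ] Z) :
    ∃ V : ℝ → Z →L[ℝ] Z, ∀ z, IsMildSolution S (fun _ x => D x) z (fun t => V t z) := by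
  obtain ⟨M, ω, hM0, hM⟩ := hS.exists_norm_le_exp
  let a := M * ‖D‖ + 1
  have ha : 0 < a := by positivity
  -- After rescaling by `exp (-(ω + a) t)` the Volterra kernel has integral less than one.
  let U : ℝ → Z →L[ℝ] Z := fun t => Real.exp (-(ω + a) * t) • S t
  have hUc : ∀ z, ContinuousOn (fun t => U t z) (Ici 0) := fun z =>
    ContinuousOn.smul (by fun_prop) (hS.cont z)
  have hUM : ∀ t, 0 ≤ t → ‖U t‖ ≤ M * Real.exp (-a * t) := fun t ht => by
    rw [norm_smul, Real.norm_of_nonneg (Real.exp_pos _).le]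
    calc Real.exp (-(ω + a) * t) * ‖S t‖ ≤ Real.exp (-(ω + a) * t) * (M * Real.exp (ω * t)) := by
          gcongr; exact hM t ht
      _ = M * Real.exp (-a * t) := by rw [mul_left_comm, ← Real.exp_add]; ring_nf
  obtain ⟨V, hVc, hV⟩ := exists_volterra_solution hUc (M := M)
    (fun t ht => (hUM t ht).trans <| mul_le_of_le_one_right hM0.le <|
      Real.exp_le_one_iff.2 <| mul_nonpos_of_nonpos_of_nonneg (neg_nonpos.2 ha.le) ht)
    (W := fun t => (U t).comp D) (fun z => hUc (D z)) (N := M * ‖D‖) (a := a)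
    (fun t ht => (ContinuousLinearMap.opNorm_comp_le _ _).trans <| by
      rw [mul_right_comm]; gcongr; exact hUM t ht) (lt_add_one _)
  refine ⟨fun t => Real.exp ((ω + a) * t) • V t,
    fun z => ⟨ContinuousOn.smul (by fun_prop) (hVc z), fun t ht => ?_⟩⟩
  have hexp : ∀ s, Real.exp ((ω + a) * t) * Real.exp (-(ω + a) * (t - s))
      = Real.exp ((ω + a) * s) := fun s => by rw [← Real.exp_add]; ring_nf
  have hexp0 : Real.exp ((ω + a) * t) * Real.exp (-(ω + a) * t) = 1 := by simpa using hexp 0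
  beta_reduce
  rw [smul_apply, hV t ht z, smul_add, smul_apply, smul_smul, hexp0, one_smul,
    ← intervalIntegral.integral_smul]
  simp only [U, ContinuousLinearMap.comp_apply, smul_apply, map_smul, smul_smul, hexp]

theorem IsC0Semigroup.of_perturbation (hS : IsC0Semigroup S)
    (hV : ∀ z, IsMildSolution S (fun _ x => D x) z (fun t => V t z)) : IsC0Semigroup V := by
  refine ⟨by ext z; exact (hV z).apply_zero hS, fun s t hs ht => ?_, fun z => (hV z).1⟩
  ext z
  have hD : ∀ z, ContinuousOn (fun t => D (V t z)) (Ici 0) := fun z =>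
    D.continuous.comp_continuousOn (hV z).1
  have hdiff := ((hV z).shift hS (hD z) ht).sub (hV (V t z)) hS.cont
    (D.continuous.comp_continuousOn ((hV z).shift hS (hD z) ht).1) (hD (V t z))
  simp only [sub_self, ← map_sub] at hdiff
  rw [add_comm, ← sub_eq_zero]
  exact IsMildSolution.eq_zero (hdiff.congr fun _ _ => rfl) hS.cont hs

theorem tendsto_quotient_perturbation_iff (hS : IsC0Semigroup S)
    (hV : ∀ z, IsMildSolution S (fun _ x => D x) z (fun t => V t z)) (z y : Z) :
    Tendsto (fun h : ℝ => h⁻¹ • (V h z - z)) (𝓝[>] 0) (𝓝 y) ↔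
      Tendsto (fun h : ℝ => h⁻¹ • (S h z - z)) (𝓝[>] 0) (𝓝 (y - D z)) := by
  have hdiff := (hV z).tendsto_quotient hS (D.continuous.comp_continuousOn (hV z).1)
  constructor
  · intro h
    refine (h.sub hdiff).congr fun h => ?_
    rw [← smul_sub, sub_sub_sub_cancel_left]
  · intro h
    rw [← sub_add_cancel y (D z)]
    refine (h.add hdiff).congr fun h => ?_
    rw [← smul_add, add_comm, sub_add_sub_cancel]

theorem Generates.vadd {A : Z →ₗ.[ℝ] Z} (hA : Generates A S)
    (hV : ∀ z, IsMildSolution S (fun _ x => D x) z (fun t => V t z)) :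
    Generates ((D : Z →ₗ[ℝ] Z) +ᵥ A) V := by
  refine ⟨hA.1.of_perturbation hV, fun z y => ?_⟩
  rw [tendsto_quotient_perturbation_iff hA.1 hV, ← hA.2]
  simp only [LinearPMap.mem_graph_iff, LinearPMap.vadd_apply]
  constructor
  · rintro ⟨x, rfl, hx⟩
    exact ⟨x, rfl, eq_sub_of_add_eq' hx⟩
  · rintro ⟨x, rfl, hx⟩
    exact ⟨x, rfl, add_eq_of_eq_sub' hx⟩

theorem IsMildSolution.hasDerivWithinAt_apply_sub (hS : IsC0Semigroup S)
    (hV : ∀ z, IsMildSolution S (fun _ x => D x) z (fun t => V t z)) {g e : ℝ → Z} {e₀ : Z}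
    (hg : ContinuousOn g (Ici 0)) (he : IsMildSolution S (fun s x => D x + g s) e₀ e) {s t : ℝ}
    (hs : 0 ≤ s) (hst : s < t) :
    HasDerivWithinAt (fun s => V (t - s) (e s)) (V (t - s) (g s)) (Ioi s) s := by
  have hVs := hS.of_perturbation hV
  have hf : ContinuousOn (fun s => D (e s) + g s) (Ici 0) :=
    (D.continuous.comp_continuousOn he.1).add hg
  have hquot : Tendsto (fun h : ℝ => h⁻¹ • (e (s + h) - V h (e s))) (𝓝[>] 0) (𝓝 (g s)) := by
    have hlim := ((he.shift hS hf hs).tendsto_quotient hS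
      (hf.comp (by fun_prop) fun h hh => add_nonneg hs hh)).sub
      ((hV (e s)).tendsto_quotient hS (D.continuous.comp_continuousOn (hV _).1))
    simpa only [← smul_sub, sub_sub_sub_cancel_right, add_zero, add_sub_cancel_left] using hlim
  have hlim : Tendsto (fun h : ℝ => V (t - s - h) (h⁻¹ • (e (s + h) - V h (e s)))) (𝓝[>] 0)
      (𝓝 (V (t - s) (g s))) := by
    refine tendsto_apply hVs.cont (sub_pos.2 hst).le ?_ ?_ hquot
    · exact tendsto_nhdsWithin_of_tendsto_nhds (Continuous.tendsto' (by fun_prop) _ _ (sub_zero _))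
    · filter_upwards [Ioo_mem_nhdsGT (sub_pos.2 hst)] with h hh using sub_nonneg.2 hh.2.le
  refine hasDerivWithinAt_Ioi_iff_tendsto.2 (hlim.congr' ?_)
  filter_upwards [Ioo_mem_nhdsGT (sub_pos.2 hst)] with h hh
  rw [map_smul, map_sub, ← hVs.add_apply (sub_nonneg.2 hh.2.le) hh.1.le, sub_add_cancel, sub_sub]

theorem IsMildSolution.perturbation (hS : IsC0Semigroup S)
    (hV : ∀ z, IsMildSolution S (fun _ x => D x) z (fun t => V t z)) {g e : ℝ → Z} {e₀ : Z}
    (hg : ContinuousOn g (Ici 0)) (he : IsMildSolution S (fun s x => D x + g s) e₀ e) :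
    IsMildSolution V (fun s _ => g s) e₀ e := by
  have hVs := hS.of_perturbation hV
  refine ⟨he.1, fun t ht => ?_⟩
  have hftc := intervalIntegral.integral_eq_sub_of_hasDeriv_right_of_le ht
    (continuousOn_apply_sub hVs.cont he.1 t)
    (fun s hs => he.hasDerivWithinAt_apply_sub hS hV hg hs.1.le hs.2)
    (intervalIntegrable_apply_sub hVs.cont hg le_rfl ht le_rfl)
  rw [hftc, sub_self, sub_zero, hVs.zero, he.apply_zero hS, ContinuousLinearMap.id_apply,
    add_sub_cancel]

theorem Generates.exists_closedLoop {nu : ℕ} {A : Z →ₗ.[ℝ] Z} (hA : Generates A S)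
    (B : EuclideanSpace ℝ (Fin nu) →L[ℝ] Z) (K : Z →L[ℝ] EuclideanSpace ℝ (Fin nu)) :
    ∃ V, Generates (closedLoop A B K) V ∧ IsFeedbackSemigroup S V B K := by
  obtain ⟨V, hV⟩ := hA.1.exists_perturbation (-(B.comp K))
  refine ⟨V, closedLoop_eq_vadd A B K ▸ hA.vadd hV, fun _ _ _ hg he => ?_⟩
  exact IsMildSolution.perturbation hA.1 hV hg (he.congr fun _ _ => sub_eq_neg_add _ _)

end Perturbation

section Generator

variable {Z : Type*} [NormedAddCommGroup Z] [InnerProductSpace ℝ Z] {S : ℝ → Z →L[ℝ] Z}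

theorem Generates.tendsto_quotient_apply {A : Z →ₗ.[ℝ] Z} (hA : Generates A S) (z : A.domain)
    (t : ℝ) : Tendsto (fun h : ℝ => S t (h⁻¹ • (S h z - z))) (𝓝[>] 0) (𝓝 (S t (A z))) :=
  ((S t).continuous.tendsto _).comp ((hA.2 z (A z)).1 (A.mem_graph z))

theorem Generates.apply_mem_graph {A : Z →ₗ.[ℝ] Z} (hA : Generates A S) (z : A.domain) {t : ℝ}
    (ht : 0 ≤ t) : (S t z, S t (A z)) ∈ A.graph := by
  refine (hA.2 _ _).2 ((hA.tendsto_quotient_apply z t).congr' ?_)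
  filter_upwards [self_mem_nhdsWithin] with h (hh : 0 < h)
  rw [map_smul, map_sub, ← hA.1.add_apply ht hh.le, ← hA.1.add_apply hh.le ht, add_comm]

theorem Generates.hasDerivWithinAt {A : Z →ₗ.[ℝ] Z} (hA : Generates A S) (z : A.domain) {t : ℝ}
    (ht : 0 ≤ t) : HasDerivWithinAt (fun s => S s z) (S t (A z)) (Ici t) t := by
  refine (hasDerivWithinAt_Ioi_iff_tendsto.2 <|
    (hA.tendsto_quotient_apply z t).congr' ?_).Ici_of_Ioi
  filter_upwards [self_mem_nhdsWithin] with h (hh : 0 < h)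
  rw [map_smul, map_sub, hA.1.add_apply ht hh.le]

theorem IsC0Semigroup.intervalIntegrable (hS : IsC0Semigroup S) (z : Z) {a b : ℝ} (ha : 0 ≤ a)
    (hb : 0 ≤ b) : IntervalIntegrable (fun s => S s z) volume a b :=
  ((hS.cont z).mono fun _ hs => (le_min ha hb).trans hs.1).intervalIntegrable

theorem IsC0Semigroup.integral_apply (hS : IsC0Semigroup S) (z : Z) {t h : ℝ} (ht : 0 ≤ t)
    (hh : 0 ≤ h) : ∫ s in (0 : ℝ)..h, S s (S t z) = ∫ s in t..(h + t), S s z := by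
  have hshift := intervalIntegral.integral_comp_add_right (a := 0) (b := h) (fun s => S s z) t
  rw [zero_add] at hshift
  rw [← hshift]
  refine intervalIntegral.integral_congr fun s hs => ?_
  rw [uIcc_of_le hh] at hs
  exact (hS.add_apply hs.1 ht z).symm

theorem IsC0Semigroup.integral_apply_sub (hS : IsC0Semigroup S) (z : Z) {t h : ℝ} (ht : 0 ≤ t)
    (hh : 0 ≤ h) :
    (∫ s in (0 : ℝ)..h, S s (S t z)) - ∫ s in (0 : ℝ)..h, S s z
      = (∫ s in (0 : ℝ)..t, S s (S h z)) - ∫ s in (0 : ℝ)..t, S s z := by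
  rw [hS.integral_apply z ht hh, hS.integral_apply z hh ht,
    intervalIntegral.integral_interval_sub_interval_comm'
      (hS.intervalIntegrable z ht (add_nonneg hh ht)) (hS.intervalIntegrable z le_rfl hh)
      (hS.intervalIntegrable z ht le_rfl), add_comm h t]

variable [CompleteSpace Z]

theorem IsC0Semigroup.apply_integral (hS : IsC0Semigroup S) (z : Z) {t h : ℝ} (ht : 0 ≤ t)
    (hh : 0 ≤ h) : S t (∫ s in (0 : ℝ)..h, S s z) = ∫ s in (0 : ℝ)..h, S s (S t z) := by
  rw [← ContinuousLinearMap.intervalIntegral_comp_comm _ (hS.intervalIntegrable z le_rfl hh)]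
  refine intervalIntegral.integral_congr fun s hs => ?_
  rw [uIcc_of_le hh] at hs
  rw [← hS.add_apply ht hs.1, ← hS.add_apply hs.1 ht, add_comm]

theorem IsC0Semigroup.tendsto_mean_orbit (hS : IsC0Semigroup S) (z : Z) :
    Tendsto (fun h : ℝ => h⁻¹ • ∫ s in (0 : ℝ)..h, S s z) (𝓝[>] 0) (𝓝 z) := by
  simpa only [hS.zero, ContinuousLinearMap.id_apply] using tendsto_mean (hS.cont z)

theorem Generates.integral_mem_domain {A : Z →ₗ.[ℝ] Z} (hA : Generates A S) (z : Z) {h : ℝ}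
    (hh : 0 ≤ h) : ∫ s in (0 : ℝ)..h, S s z ∈ A.domain := by
  refine LinearPMap.mem_domain_of_mem_graph ((hA.2 _ (S h z - z)).2 ?_)
  refine ((hA.1.tendsto_mean_orbit (S h z)).sub (hA.1.tendsto_mean_orbit z)).congr' ?_
  filter_upwards [self_mem_nhdsWithin] with t (ht : 0 < t)
  rw [← smul_sub, ← hA.1.integral_apply_sub z ht.le hh, hA.1.apply_integral z ht.le hh]

theorem Generates.dense_domain {A : Z →ₗ.[ℝ] Z} (hA : Generates A S) :
    Dense (A.domain : Set Z) := fun z => by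
  refine mem_closure_of_tendsto (hA.1.tendsto_mean_orbit z) ?_
  filter_upwards [self_mem_nhdsWithin] with h (hh : 0 < h)
  exact A.domain.smul_mem _ (hA.integral_mem_domain z hh.le)

end Generator

section Lyapunov

theorem le_mul_exp_of_hasDerivWithinAt {V d : ℝ → ℝ} {a : ℝ} (hV : ContinuousOn V (Ici 0))
    (hd : ∀ s, 0 ≤ s → HasDerivWithinAt V (d s) (Ici s) s) (hda : ∀ s, 0 ≤ s → d s ≤ a * V s)
    {t : ℝ} (ht : 0 ≤ t) : V t ≤ V 0 * Real.exp (a * t) := by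
  have hgronwall := le_gronwallBound_of_liminf_deriv_right_le (hV.mono Icc_subset_Ici_self)
    (fun s hs _ hr => (hd s hs.1).liminf_right_slope_le hr) le_rfl
    (fun s hs => (hda s hs.1).trans_eq (add_zero _).symm) t ⟨ht, le_rfl⟩
  rwa [gronwallBound_ε0, sub_zero] at hgronwall

variable {Z : Type*} [NormedAddCommGroup Z] [InnerProductSpace ℝ Z] {S : ℝ → Z →L[ℝ] Z}
  {P : Z →L[ℝ] Z} {lam c : ℝ}

theorem isExpStable_of_inner_le (hc : 0 < c) (hlam : 0 < lam)
    (hcoer : ∀ z : Z, c * ‖z‖ ^ 2 ≤ inner ℝ z (P z))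
    (hdecay : ∀ z t, 0 ≤ t →
      inner ℝ (S t z) (P (S t z)) ≤ inner ℝ z (P z) * Real.exp (-lam * t)) :
    IsExpStable S := by
  refine ⟨√(‖P‖ / c) + 1, lam / 2, by positivity, half_pos hlam, fun t ht =>
    ContinuousLinearMap.opNorm_le_bound _ (by positivity) fun z => ?_⟩
  have hsq : c * ‖S t z‖ ^ 2 ≤ c * (√(‖P‖ / c) * Real.exp (-(lam / 2) * t) * ‖z‖) ^ 2 :=
    calc c * ‖S t z‖ ^ 2 ≤ inner ℝ z (P z) * Real.exp (-lam * t) :=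
          (hcoer _).trans (hdecay z t ht)
      _ ≤ ‖z‖ * (‖P‖ * ‖z‖) * Real.exp (-lam * t) := by
          gcongr
          exact (real_inner_le_norm _ _).trans (by gcongr; exact P.le_opNorm z)
      _ = c * (√(‖P‖ / c) * Real.exp (-(lam / 2) * t) * ‖z‖) ^ 2 := by
          rw [mul_pow, mul_pow, Real.sq_sqrt (by positivity), ← Real.exp_nat_mul]
          field_simp
          norm_num
  refine (le_of_sq_le_sq (le_of_mul_le_mul_left hsq hc) (by positivity)).trans ?_
  gcongr
  exact le_add_of_nonneg_right zero_le_one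

variable [CompleteSpace Z] {A : Z →ₗ.[ℝ] Z}

theorem Generates.inner_apply_le_of_mem_domain (hA : Generates A S) (hP : IsSelfAdjoint P)
    (hdiss : ∀ z : A.domain,
      inner ℝ (A z) (P (z : Z)) + inner ℝ (P (z : Z)) (A z) ≤ -lam * inner ℝ (z : Z) (P (z : Z)))
    {z : Z} (hz : z ∈ A.domain) {t : ℝ} (ht : 0 ≤ t) :
    inner ℝ (S t z) (P (S t z)) ≤ inner ℝ z (P z) * Real.exp (-lam * t) := by
  have hcont : ContinuousOn (fun s => inner ℝ (S s z) (P (S s z))) (Ici 0) :=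
    (hA.1.cont z).inner (P.continuous.comp_continuousOn (hA.1.cont z))
  have hderiv : ∀ s, 0 ≤ s → HasDerivWithinAt (fun s => inner ℝ (S s z) (P (S s z)))
      (inner ℝ (S s z) (P (S s (A ⟨z, hz⟩))) + inner ℝ (S s (A ⟨z, hz⟩)) (P (S s z)))
      (Ici s) s := fun s hs =>
    (hA.hasDerivWithinAt ⟨z, hz⟩ hs).inner ℝ
      (P.hasFDerivAt.comp_hasDerivWithinAt s (hA.hasDerivWithinAt ⟨z, hz⟩ hs))
  have hdecay := le_mul_exp_of_hasDerivWithinAt (a := -lam) hcont hderiv (fun s hs => ?_) ht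
  · simpa only [hA.1.zero, ContinuousLinearMap.id_apply] using hdecay
  · obtain ⟨w, hw, hAw⟩ := (LinearPMap.mem_graph_iff _).1 (hA.apply_mem_graph ⟨z, hz⟩ hs)
    have hPw : inner ℝ (S s z) (P (S s (A ⟨z, hz⟩))) = inner ℝ (P (S s z)) (S s (A ⟨z, hz⟩)) :=
      (hP.isSymmetric _ _).symm
    have hw_diss := hdiss w
    rw [hw, hAw] at hw_diss
    rwa [hPw, add_comm]

theorem Generates.inner_apply_le (hA : Generates A S) (hP : IsSelfAdjoint P)
    (hdiss : ∀ z : A.domain,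
      inner ℝ (A z) (P (z : Z)) + inner ℝ (P (z : Z)) (A z) ≤ -lam * inner ℝ (z : Z) (P (z : Z)))
    (z : Z) {t : ℝ} (ht : 0 ≤ t) :
    inner ℝ (S t z) (P (S t z)) ≤ inner ℝ z (P z) * Real.exp (-lam * t) :=
  hA.dense_domain.induction (fun _ hz => hA.inner_apply_le_of_mem_domain hP hdiss hz ht)
    (isClosed_le (by fun_prop) (by fun_prop)) z

theorem Generates.isExpStable (hA : Generates A S) (hL : HasCoerciveLyapunov A) :
    IsExpStable S := by
  obtain ⟨P, lam, c, hP, hlam, hc, hcoer, hdiss⟩ := hL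
  exact isExpStable_of_inner_le hc hlam hcoer fun z t ht => hA.inner_apply_le hP hdiss z ht

end Lyapunov

section Adjoint

theorem tendsto_apply_of_dense {ι E F : Type*} [NormedAddCommGroup E] [NormedSpace ℝ E]
    [NormedAddCommGroup F] [NormedSpace ℝ F] {l : Filter ι} {T : ι → E →L[ℝ] F} {T₀ : E →L[ℝ] F}
    {M : ℝ} (hM : ∀ᶠ i in l, ‖T i‖ ≤ M)
    (hdense : Dense {z | Tendsto (fun i => T i z) l (𝓝 (T₀ z))}) (z : E) :
    Tendsto (fun i => T i z) l (𝓝 (T₀ z)) := by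
  have hrestrict : ∀ z, Tendsto (fun i : {i // ‖T i‖ ≤ M} => T i z) (comap (↑) l) (𝓝 (T₀ z)) ↔
      Tendsto (fun i => T i z) l (𝓝 (T₀ z)) := fun z =>
    tendsto_comap'_iff (m := fun i => T i z) (i := ((↑) : {i // ‖T i‖ ≤ M} → ι))
      (by rwa [Subtype.range_coe_subtype])
  have hequi : Equicontinuous fun (i : {i // ‖T i‖ ≤ M}) z => T i z :=
    (LipschitzWith.uniformEquicontinuous (fun (i : {i // ‖T i‖ ≤ M}) z => T i z) M.toNNReal fun i =>
      (T i).lipschitz.weaken (NNReal.le_toNNReal_of_coe_le i.2)).equicontinuous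
  have hclosed := hequi.isClosed_setOfPred_tendsto (l := comap (↑) l) T₀.continuous
  simp only [hrestrict] at hclosed
  exact hclosed.closure_subset (hdense z)

theorem norm_integral_apply_le {E F : Type*} [NormedAddCommGroup E] [NormedSpace ℝ E]
    [NormedAddCommGroup F] [NormedSpace ℝ F] {S : ℝ → E →L[ℝ] F} {M t : ℝ} (ht : 0 ≤ t)
    (hM : ∀ s ∈ Icc 0 t, ‖S s‖ ≤ M) (z : E) : ‖∫ s in (0 : ℝ)..t, S s z‖ ≤ M * t * ‖z‖ := by
  have hbound := intervalIntegral.norm_integral_le_of_norm_le_const (a := 0) (b := t)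
    (f := fun s => S s z) (C := M * ‖z‖) fun s hs => by
      rw [uIoc_of_le ht] at hs
      exact (S s).le_of_opNorm_le (hM s ⟨hs.1.le, hs.2⟩) z
  rwa [sub_zero, abs_of_nonneg ht, mul_right_comm] at hbound

variable {Z : Type*} [NormedAddCommGroup Z] [InnerProductSpace ℝ Z] {S T : ℝ → Z →L[ℝ] Z}

theorem norm_apply_sub_apply_le (hadd : ∀ s t : ℝ, 0 ≤ s → 0 ≤ t → T (s + t) = (T s).comp (T t))
    {M a s t : ℝ} (hM : ∀ r ∈ Icc 0 a, ‖T r‖ ≤ M) (hs : s ∈ Icc 0 a) (ht : t ∈ Icc 0 a) (z : Z) :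
    ‖T s z - T t z‖ ≤ M * ‖T |s - t| z - z‖ := by
  wlog hst : t ≤ s generalizing s t
  · rw [norm_sub_rev, abs_sub_comm]
    exact this ht hs (le_of_not_ge hst)
  have hsplit : T s z = T t (T (s - t) z) := by
    rw [← ContinuousLinearMap.comp_apply, ← hadd t _ ht.1 (sub_nonneg.2 hst), add_sub_cancel]
  rw [abs_of_nonneg (sub_nonneg.2 hst), hsplit, ← map_sub]
  exact (T t).le_of_opNorm_le (hM t ht) _

theorem IsC0Semigroup.of_tendsto_zero (h0 : T 0 = ContinuousLinearMap.id ℝ Z)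
    (hadd : ∀ s t : ℝ, 0 ≤ s → 0 ≤ t → T (s + t) = (T s).comp (T t))
    (hM : ∀ a : ℝ, ∃ M : ℝ, ∀ t ∈ Icc 0 a, ‖T t‖ ≤ M)
    (hlim : ∀ z, Tendsto (fun t => T t z) (𝓝[>] 0) (𝓝 z)) : IsC0Semigroup T := by
  refine ⟨h0, hadd, fun z t (ht : 0 ≤ t) => ?_⟩
  obtain ⟨M, hM⟩ := hM (t + 1)
  have hcont0 : Tendsto (fun t => T t z) (𝓝[≥] 0) (𝓝 z) := by
    have hcont := continuousWithinAt_Ioi_iff_Ici (f := fun t => T t z) (a := 0)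
    simp only [ContinuousWithinAt, h0, ContinuousLinearMap.id_apply] at hcont
    exact hcont.1 (hlim z)
  have habs : Tendsto (fun s => |s - t|) (𝓝[Ici 0] t) (𝓝[≥] 0) :=
    tendsto_nhdsWithin_iff.2 ⟨tendsto_nhdsWithin_of_tendsto_nhds
      (Continuous.tendsto' (by fun_prop) _ _ (by rw [sub_self, abs_zero])),
      Eventually.of_forall fun _ => mem_Ici.2 (abs_nonneg _)⟩
  have hbound : Tendsto (fun s => M * ‖T |s - t| z - z‖) (𝓝[Ici 0] t) (𝓝 0) := by
    simpa using (((hcont0.comp habs).sub_const z).norm).const_mul M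
  refine tendsto_iff_norm_sub_tendsto_zero.2 (squeeze_zero' (Eventually.of_forall fun _ =>
    norm_nonneg _) ?_ hbound)
  filter_upwards [self_mem_nhdsWithin, nhdsWithin_le_nhds (Iic_mem_nhds (lt_add_one t))]
    with s hs0 hs1
  exact norm_apply_sub_apply_le hadd hM ⟨hs0, hs1⟩ ⟨ht, (lt_add_one t).le⟩ z

/-- The subspace of the vectors `z` with `T t z → z` as `t ↓ 0`, on which strong continuity of the
operator family `T` at the origin holds. -/
noncomputable def continuitySubmodule (T : ℝ → Z →L[ℝ] Z) : Submodule ℝ Z where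
  carrier := {z | Tendsto (fun t => T t z) (𝓝[>] 0) (𝓝 z)}
  add_mem' {x y} hx hy := by simpa only [mem_ofPred_eq, map_add] using hx.add hy
  zero_mem' := by simp only [mem_ofPred_eq, map_zero, tendsto_const_nhds]
  smul_mem' c x hx := by simpa only [mem_ofPred_eq, map_smul] using hx.const_smul c

variable [CompleteSpace Z]

/-- The operator `z ↦ ∫₀ʰ S s z ds` for a strongly continuous family `S`. It smooths: the range of
its adjoint consists of vectors on which the adjoint semigroup is strongly continuous. -/
noncomputable def integralCLM (hS : ∀ z, ContinuousOn (fun t => S t z) (Ici 0)) {h : ℝ}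
    (hh : 0 ≤ h) : Z →L[ℝ] Z :=
  have hint : ∀ z, IntervalIntegrable (fun s => S s z) volume 0 h := fun z =>
    ((hS z).mono (uIcc_of_le hh ▸ Icc_subset_Ici_self)).intervalIntegrable
  LinearMap.mkContinuousOfExistsBound
    { toFun := fun z => ∫ s in (0 : ℝ)..h, S s z
      map_add' := fun x y => by
        simp only [map_add, intervalIntegral.integral_add (hint x) (hint y)]
      map_smul' := fun c x => by
        simp only [map_smul, intervalIntegral.integral_smul, RingHom.id_apply] }
    (let ⟨M, _, hM⟩ := exists_norm_le_of_continuousOn hS h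
     ⟨M * h, norm_integral_apply_le hh hM⟩)

theorem integralCLM_apply (hS : ∀ z, ContinuousOn (fun t => S t z) (Ici 0)) {h : ℝ} (hh : 0 ≤ h)
    (z : Z) : integralCLM hS hh z = ∫ s in (0 : ℝ)..h, S s z :=
  rfl

theorem IsC0Semigroup.norm_integralCLM_comp_sub_le (hS : IsC0Semigroup S) {h t M : ℝ} (hh : 0 ≤ h)
    (ht : 0 ≤ t) (hM : ∀ s ∈ Icc 0 t, ‖S s‖ ≤ M) :
    ‖(integralCLM hS.cont hh).comp (S t) - integralCLM hS.cont hh‖ ≤ M * t * (‖S h‖ + 1) := by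
  have hM0 : 0 ≤ M := (norm_nonneg _).trans (hM 0 ⟨le_rfl, ht⟩)
  refine ContinuousLinearMap.opNorm_le_bound _ (by positivity) fun z => ?_
  have hswap : ((integralCLM hS.cont hh).comp (S t) - integralCLM hS.cont hh) z
      = (∫ s in (0 : ℝ)..t, S s (S h z)) - ∫ s in (0 : ℝ)..t, S s z :=
    hS.integral_apply_sub z ht hh
  rw [hswap]
  calc ‖(∫ s in (0 : ℝ)..t, S s (S h z)) - ∫ s in (0 : ℝ)..t, S s z‖
      ≤ M * t * (‖S h‖ * ‖z‖) + M * t * ‖z‖ := (norm_sub_le _ _).trans <|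
        add_le_add ((norm_integral_apply_le ht hM _).trans <| by gcongr; exact (S h).le_opNorm z)
          (norm_integral_apply_le ht hM z)
    _ = M * t * (‖S h‖ + 1) * ‖z‖ := by ring

theorem norm_adjSemigroup (S : ℝ → Z →L[ℝ] Z) (t : ℝ) : ‖adjSemigroup S t‖ = ‖S t‖ :=
  LinearIsometryEquiv.norm_map _ _

theorem IsC0Semigroup.adjoint_integralCLM_mem (hS : IsC0Semigroup S) {h : ℝ} (hh : 0 ≤ h) (y : Z) :
    ContinuousLinearMap.adjoint (integralCLM hS.cont hh) y
      ∈ continuitySubmodule (SDAC.adjSemigroup S) := by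
  set L := integralCLM hS.cont hh
  obtain ⟨M, -, hM⟩ := exists_norm_le_of_continuousOn hS.cont 1
  have hlim : Tendsto (fun t : ℝ => M * t * (‖S h‖ + 1) * ‖y‖) (𝓝[>] 0) (𝓝 0) :=
    tendsto_nhdsWithin_of_tendsto_nhds (Continuous.tendsto' (by fun_prop) _ _ (by simp))
  refine tendsto_iff_norm_sub_tendsto_zero.2 (squeeze_zero' (Eventually.of_forall fun _ =>
    norm_nonneg _) ?_ hlim)
  filter_upwards [Ioo_mem_nhdsGT one_pos] with t ht
  have hadj : adjSemigroup S t (ContinuousLinearMap.adjoint L y) - ContinuousLinearMap.adjoint L y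
      = ContinuousLinearMap.adjoint (L.comp (S t) - L) y := by
    rw [map_sub, ContinuousLinearMap.adjoint_comp]
    rfl
  rw [hadj]
  refine ContinuousLinearMap.le_of_opNorm_le _ ?_ y
  rw [LinearIsometryEquiv.norm_map]
  exact hS.norm_integralCLM_comp_sub_le hh ht.1.le fun s hs => hM s ⟨hs.1, hs.2.trans ht.2.le⟩

theorem IsC0Semigroup.dense_continuitySubmodule_adjSemigroup (hS : IsC0Semigroup S) :
    Dense (continuitySubmodule (SDAC.adjSemigroup S) : Set Z) := by
  rw [Submodule.dense_iff_topologicalClosure_eq_top, Submodule.topologicalClosure_eq_top_iff,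
    Submodule.eq_bot_iff]
  intro y hy
  have hmean := (hS.tendsto_mean_orbit y).inner (𝕜 := ℝ) (tendsto_const_nhds (x := y))
  refine inner_self_eq_zero.1 (tendsto_nhds_unique_of_eventuallyEq hmean
    (tendsto_const_nhds (x := (0 : ℝ))) ?_)
  filter_upwards [self_mem_nhdsWithin] with h (hh : 0 < h)
  have horth := (Submodule.mem_orthogonal' _ _).1 hy _ (hS.adjoint_integralCLM_mem hh.le y)
  rw [ContinuousLinearMap.adjoint_inner_right, integralCLM_apply] at horth
  rw [inner_smul_left, horth, mul_zero]

theorem IsC0Semigroup.adjSemigroup (hS : IsC0Semigroup S) : IsC0Semigroup (adjSemigroup S) := by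
  have hM : ∀ a : ℝ, ∃ M : ℝ, ∀ t ∈ Icc 0 a, ‖SDAC.adjSemigroup S t‖ ≤ M := fun a => by
    obtain ⟨M, -, hM⟩ := exists_norm_le_of_continuousOn hS.cont a
    exact ⟨M, fun t ht => (norm_adjSemigroup S t).trans_le (hM t ht)⟩
  refine .of_tendsto_zero ?_ (fun s t hs ht => ?_) hM fun z => ?_
  · rw [SDAC.adjSemigroup, hS.zero, ContinuousLinearMap.adjoint_id]
  · simp only [SDAC.adjSemigroup]
    rw [add_comm, hS.add t s ht hs, ContinuousLinearMap.adjoint_comp]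
  · obtain ⟨M, hM⟩ := hM 1
    refine tendsto_apply_of_dense (T₀ := ContinuousLinearMap.id ℝ Z) (M := M) ?_
      hS.dense_continuitySubmodule_adjSemigroup z
    filter_upwards [Ioo_mem_nhdsGT one_pos] with t ht using hM t (Ioo_subset_Icc_self ht)

end Adjoint

section Decay

/-- Exponential decay of a continuous signal on `[0, ∞)`: `‖f t‖ ≤ c e^{-β t}`. The amplitude `c`
and the rate `β` are kept explicit, to make the estimates uniform in the initial data. -/
structure HasExpDecay {E : Type*} [NormedAddCommGroup E] (f : ℝ → E) (c β : ℝ) : Prop where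
  continuousOn : ContinuousOn f (Ici 0)
  norm_le : ∀ t, 0 ≤ t → ‖f t‖ ≤ c * Real.exp (-β * t)

section NormedGroup

variable {E : Type*} [NormedAddCommGroup E] {f g : ℝ → E} {c c' β β' : ℝ}

theorem HasExpDecay.nonneg (hf : HasExpDecay f c β) : 0 ≤ c := by
  simpa using (norm_nonneg _).trans (hf.norm_le 0 le_rfl)

theorem HasExpDecay.mono (hf : HasExpDecay f c β) (hc : c ≤ c') (hβ : β' ≤ β) :
    HasExpDecay f c' β' :=
  ⟨hf.continuousOn, fun t ht => (hf.norm_le t ht).trans <| by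
    have := hf.nonneg.trans hc
    gcongr⟩

theorem HasExpDecay.add (hf : HasExpDecay f c β) (hg : HasExpDecay g c' β) :
    HasExpDecay (fun t => f t + g t) (c + c') β :=
  ⟨hf.continuousOn.add hg.continuousOn, fun t ht => (norm_add_le _ _).trans <|
    (add_le_add (hf.norm_le t ht) (hg.norm_le t ht)).trans_eq (add_mul _ _ _).symm⟩

theorem hasExpDecay_const (z : E) : HasExpDecay (fun _ => z) ‖z‖ 0 :=
  ⟨continuousOn_const, fun t _ => by simp⟩

theorem HasExpDecay.norm_le_mul {x : ℝ} (hf : HasExpDecay f (c * x) β) (t : ℝ) (ht : 0 ≤ t) :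
    ‖f t‖ ≤ c * Real.exp (-β * t) * x :=
  (hf.norm_le t ht).trans_eq (mul_right_comm _ _ _)

theorem HasExpDecay.integrableOn_Ioi (hf : HasExpDecay f c β) (hβ : 0 < β) :
    IntegrableOn f (Ioi 0) := by
  refine Integrable.mono' ((exp_neg_integrableOn_Ioi 0 hβ).const_mul c)
    ((hf.continuousOn.mono Ioi_subset_Ici_self).aestronglyMeasurable measurableSet_Ioi) ?_
  filter_upwards [ae_restrict_mem measurableSet_Ioi] with t (ht : 0 < t) using hf.norm_le t ht.le

theorem HasExpDecay.memLp_top (hf : HasExpDecay f c β) (hβ : 0 ≤ β) :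
    MemLp f ⊤ (volume.restrict (Ici 0)) := by
  refine memLp_top_of_bound (hf.continuousOn.aestronglyMeasurable measurableSet_Ici) c ?_
  filter_upwards [ae_restrict_mem measurableSet_Ici] with t (ht : 0 ≤ t)
  simpa using (hf.mono le_rfl hβ).norm_le t ht

end NormedGroup

variable {E F : Type*} [NormedAddCommGroup E] [NormedSpace ℝ E]
  [NormedAddCommGroup F] [NormedSpace ℝ F] {f : ℝ → E} {M c β : ℝ}

theorem HasExpDecay.norm_integral_Ioi_le (hf : HasExpDecay f c β) (hβ : 0 < β) :
    ‖∫ t in Ioi (0 : ℝ), f t‖ ≤ c * ∫ t in Ioi (0 : ℝ), Real.exp (-β * t) := by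
  rw [← integral_const_mul]
  refine norm_integral_le_of_norm_le ((exp_neg_integrableOn_Ioi 0 hβ).const_mul c) ?_
  filter_upwards [ae_restrict_mem measurableSet_Ioi] with t (ht : 0 < t) using hf.norm_le t ht.le

theorem HasExpDecay.clm_comp (hf : HasExpDecay f c β) (L : E →L[ℝ] F) :
    HasExpDecay (fun t => L (f t)) (‖L‖ * c) β :=
  ⟨L.continuous.comp_continuousOn hf.continuousOn, fun t ht =>
    (L.le_opNorm_of_le (hf.norm_le t ht)).trans_eq (mul_assoc _ _ _).symm⟩

theorem HasExpDecay.clm_apply [CompleteSpace E] {S : ℝ → E →L[ℝ] F}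
    (hS : ∀ z, ContinuousOn (fun t => S t z) (Ici 0))
    (hM : ∀ t, 0 ≤ t → ‖S t‖ ≤ M * Real.exp (-β * t)) (hf : HasExpDecay f c 0) :
    HasExpDecay (fun t => S t (f t)) (M * c) β := by
  refine ⟨continuousOn_comp_apply hS continuousOn_id (fun _ h => h) hf.continuousOn, fun t ht => ?_⟩
  have hft : ‖f t‖ ≤ c := by simpa using hf.norm_le t ht
  exact ((S t).le_of_opNorm_le_of_le (hM t ht) hft).trans_eq (mul_right_comm _ _ _)

theorem mul_exp_neg_mul_le (hβ : 0 < β) (t : ℝ) :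
    t * Real.exp (-β * t) ≤ 2 / β * Real.exp (-(β / 2) * t) := by
  have hlin : β / 2 * t ≤ Real.exp (β / 2 * t) :=
    (le_add_of_nonneg_right zero_le_one).trans (Real.add_one_le_exp _)
  calc t * Real.exp (-β * t) = 2 / β * (β / 2 * t * Real.exp (-β * t)) := by field_simp
    _ ≤ 2 / β * (Real.exp (β / 2 * t) * Real.exp (-β * t)) := by gcongr
    _ = 2 / β * Real.exp (-(β / 2) * t) := by rw [← Real.exp_add]; ring_nf

-- The convolution of two exponentials of the same rate is `t e^{-β t}`, hence the loss in the rate.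
theorem HasExpDecay.convolution [CompleteSpace E] {S : ℝ → E →L[ℝ] F}
    (hS : ∀ z, ContinuousOn (fun t => S t z) (Ici 0)) (hβ : 0 < β)
    (hM : ∀ t, 0 ≤ t → ‖S t‖ ≤ M * Real.exp (-β * t)) (hf : HasExpDecay f c β) :
    HasExpDecay (fun t => ∫ s in (0 : ℝ)..t, S (t - s) (f s)) (M * c * (2 / β)) (β / 2) := by
  have hM0 : 0 ≤ M := by simpa using (norm_nonneg _).trans (hM 0 le_rfl)
  refine ⟨continuousOn_convolution hS hf.continuousOn, fun t ht => ?_⟩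
  have hbound := intervalIntegral.norm_integral_le_of_norm_le_const (a := 0) (b := t)
    (f := fun s => S (t - s) (f s)) (C := M * c * Real.exp (-β * t)) fun s hs => by
      rw [uIoc_of_le ht] at hs
      calc ‖S (t - s) (f s)‖ ≤ M * Real.exp (-β * (t - s)) * (c * Real.exp (-β * s)) :=
            (S _).le_of_opNorm_le_of_le (hM _ (sub_nonneg.2 hs.2)) (hf.norm_le s hs.1.le)
        _ = M * c * (Real.exp (-β * (t - s)) * Real.exp (-β * s)) := by ring
        _ = M * c * Real.exp (-β * t) := by rw [← Real.exp_add]; ring_nf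
  rw [sub_zero, abs_of_nonneg ht] at hbound
  calc ‖∫ s in (0 : ℝ)..t, S (t - s) (f s)‖ ≤ M * c * (t * Real.exp (-β * t)) :=
        hbound.trans_eq (by ring)
    _ ≤ M * c * (2 / β * Real.exp (-(β / 2) * t)) :=
        mul_le_mul_of_nonneg_left (mul_exp_neg_mul_le hβ t) (mul_nonneg hM0 hf.nonneg)
    _ = M * c * (2 / β) * Real.exp (-(β / 2) * t) := (mul_assoc _ _ _).symm

/-- The amplitude of the signal `-K e + g` driving `e' = A e + B (-K e + g)`, per unit of `‖e 0‖`,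
when `‖g t‖ ≤ a e^{-β t} ‖e 0‖` and the closed-loop semigroup is bounded by `M e^{-β t}`. -/
noncomputable def signalAmplitude (B : F →L[ℝ] E) (K : E →L[ℝ] F) (M β a : ℝ) : ℝ :=
  ‖K‖ * (M + M * (‖B‖ * a) * (2 / β)) + a

theorem le_signalAmplitude (B : F →L[ℝ] E) (K : E →L[ℝ] F) {a : ℝ} (hM : 0 ≤ M) (hβ : 0 ≤ β)
    (ha : 0 ≤ a) : a ≤ signalAmplitude B K M β a :=
  le_add_of_nonneg_left (by positivity)

end Decay

section Control

variable {Z : Type*} [NormedAddCommGroup Z] [InnerProductSpace ℝ Z] [CompleteSpace Z] {nu ny : ℕ}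
  {S Sm : ℝ → Z →L[ℝ] Z} {M c β : ℝ}

theorem IsC0Semigroup.hasExpDecay_orbit (hSm : IsC0Semigroup Sm)
    (hM : ∀ t, 0 ≤ t → ‖Sm t‖ ≤ M * Real.exp (-β * t)) (z : Z) :
    HasExpDecay (fun t => Sm t z) (M * ‖z‖) β :=
  (hasExpDecay_const z).clm_apply hSm.cont hM

theorem IsC0Semigroup.hasExpDecay_adjSemigroup (hSm : IsC0Semigroup Sm)
    (hM : ∀ t, 0 ≤ t → ‖Sm t‖ ≤ M * Real.exp (-β * t)) (z : Z) :
    HasExpDecay (fun t => SDAC.adjSemigroup Sm t z) (M * ‖z‖) β :=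
  hSm.adjSemigroup.hasExpDecay_orbit (fun t ht => (norm_adjSemigroup Sm t).trans_le (hM t ht)) z

theorem IsC0Semigroup.hasExpDecay_gramianIntegrand (hSm : IsC0Semigroup Sm) (hβ : 0 ≤ β)
    (hM : ∀ t, 0 ≤ t → ‖Sm t‖ ≤ M * Real.exp (-β * t))
    (C : Z →L[ℝ] EuclideanSpace ℝ (Fin ny)) (z : Z) :
    HasExpDecay (gramianIntegrand Sm C z)
      (M * (‖ContinuousLinearMap.adjoint C‖ * (‖C‖ * (M * ‖z‖)))) β :=
  ((((hSm.hasExpDecay_orbit hM z).mono le_rfl hβ).clm_comp C).clm_comp _).clm_apply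
    hSm.adjSemigroup.cont fun t ht => (norm_adjSemigroup Sm t).trans_le (hM t ht)

theorem IsExpStable.integrableOn_adjSemigroup (hst : IsExpStable Sm) (hSm : IsC0Semigroup Sm)
    (z : Z) : IntegrableOn (fun τ => adjSemigroup Sm τ z) (Ioi 0) :=
  let ⟨_, _, _, hβ, hM⟩ := hst
  (hSm.hasExpDecay_adjSemigroup hM z).integrableOn_Ioi hβ

theorem IsExpStable.integrableOn_gramianIntegrand (hst : IsExpStable Sm) (hSm : IsC0Semigroup Sm)
    (C : Z →L[ℝ] EuclideanSpace ℝ (Fin ny)) (z : Z) :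
    IntegrableOn (gramianIntegrand Sm C z) (Ioi 0) :=
  let ⟨_, _, _, hβ, hM⟩ := hst
  (hSm.hasExpDecay_gramianIntegrand hβ.le hM C z).integrableOn_Ioi hβ

theorem IsExpStable.exists_norm_gramian_le (hst : IsExpStable Sm) (hSm : IsC0Semigroup Sm)
    (C : Z →L[ℝ] EuclideanSpace ℝ (Fin ny)) : ∃ N : ℝ, ∀ z, ‖gramian Sm C z‖ ≤ N * ‖z‖ := by
  obtain ⟨M, β, -, hβ, hM⟩ := hst
  refine ⟨M * (‖ContinuousLinearMap.adjoint C‖ * (‖C‖ * M))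
    * ∫ t in Ioi (0 : ℝ), Real.exp (-β * t), fun z => ?_⟩
  exact ((hSm.hasExpDecay_gramianIntegrand hβ.le hM C z).norm_integral_Ioi_le hβ).trans_eq (by ring)

/-- The observability Gramian of an exponentially stable semigroup as a bounded operator. -/
noncomputable def gramianCLM (hst : IsExpStable Sm) (hSm : IsC0Semigroup Sm)
    (C : Z →L[ℝ] EuclideanSpace ℝ (Fin ny)) : Z →L[ℝ] Z :=
  have hint := hst.integrableOn_gramianIntegrand hSm C
  LinearMap.mkContinuousOfExistsBound
    { toFun := gramian Sm C
      map_add' := fun x y => by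
        simp only [gramian]
        rw [← integral_add (hint x) (hint y)]
        simp only [gramianIntegrand, map_add]
      map_smul' := fun a x => by
        simp only [gramian, ← integral_smul, gramianIntegrand, map_smul, RingHom.id_apply] }
    (hst.exists_norm_gramian_le hSm C)

theorem gramianCLM_apply (hst : IsExpStable Sm) (hSm : IsC0Semigroup Sm)
    (C : Z →L[ℝ] EuclideanSpace ℝ (Fin ny)) (z : Z) : gramianCLM hst hSm C z = gramian Sm C z :=
  rfl

theorem IsC0Semigroup.costate_eq (hSm : IsC0Semigroup Sm) (C : Z →L[ℝ] EuclideanSpace ℝ (Fin ny))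
    (r : EuclideanSpace ℝ (Fin ny)) {v : ℝ → Z} {v₀ : Z} (hv : ∀ t, 0 ≤ t → v t = Sm t v₀)
    {t T : ℝ} (ht : 0 ≤ t) (hT : t ≤ T) :
    costate Sm C (fun s => r - C (v s)) T t
      = -∫ τ in (0 : ℝ)..T - t, (SDAC.adjSemigroup Sm τ (ContinuousLinearMap.adjoint C r)
          - gramianIntegrand Sm C (v t) τ) := by
  have hshift := intervalIntegral.integral_comp_sub_right (a := t) (b := T)
    (fun τ => SDAC.adjSemigroup Sm τ (ContinuousLinearMap.adjoint C r)
      - gramianIntegrand Sm C (v t) τ) t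
  rw [sub_self] at hshift
  rw [← hshift, costate, intervalIntegral.integral_symm]
  refine congrArg _ (intervalIntegral.integral_congr fun s hs => ?_)
  rw [uIcc_of_le hT] at hs
  have horbit : v s = Sm (s - t) (v t) := by
    rw [hv t ht, ← hSm.add_apply (sub_nonneg.2 hs.1) ht, sub_add_cancel, hv s (ht.trans hs.1)]
  simp only [gramianIntegrand, horbit, map_sub]

theorem IsExpStable.tendsto_costate (hst : IsExpStable Sm) (hSm : IsC0Semigroup Sm)
    (C : Z →L[ℝ] EuclideanSpace ℝ (Fin ny)) (r : EuclideanSpace ℝ (Fin ny)) {v : ℝ → Z} {v₀ : Z}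
    (hv : ∀ t, 0 ≤ t → v t = Sm t v₀) {t : ℝ} (ht : 0 ≤ t) :
    Tendsto (fun T : ℝ => costate Sm C (fun s => r - C (v s)) T t) atTop
      (𝓝 (staticFeedforward Sm C r (v t))) := by
  have hint_ref := hst.integrableOn_adjSemigroup hSm (ContinuousLinearMap.adjoint C r)
  have hint_gram := hst.integrableOn_gramianIntegrand hSm C (v t)
  have hvalue : -∫ τ in Ioi (0 : ℝ), (adjSemigroup Sm τ (ContinuousLinearMap.adjoint C r)
      - gramianIntegrand Sm C (v t) τ) = staticFeedforward Sm C r (v t) := by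
    rw [integral_sub hint_ref hint_gram, neg_sub, sub_eq_add_neg]
    rfl
  have hlim := (intervalIntegral_tendsto_integral_Ioi 0 (hint_ref.sub hint_gram)
    (tendsto_atTop_add_const_right atTop (-t) tendsto_id)).neg
  rw [← hvalue]
  refine hlim.congr' ?_
  filter_upwards [eventually_ge_atTop t] with T hT using (hSm.costate_eq C r hv ht hT).symm

/-- The SDAC law `u = -K v_h - Q q`, with `q` the static feedforward, for an arbitrary feedback gain
`K` and feedforward gain `Q` in place of the optimal ones. -/
noncomputable def sdacFeedback (Sm : ℝ → Z →L[ℝ] Z) (C : Z →L[ℝ] EuclideanSpace ℝ (Fin ny))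
    (K Q : Z →L[ℝ] EuclideanSpace ℝ (Fin nu)) (r : EuclideanSpace ℝ (Fin ny)) (vp vh : Z) :
    EuclideanSpace ℝ (Fin nu) :=
  -K vh - Q (staticFeedforward Sm C r vp)

/-- The tracking law `u = -K v - Q (A_m*)⁻¹ C* r`, for an arbitrary feedback gain `K` and
feedforward gain `Q` in place of the optimal ones. -/
noncomputable def lqtFeedback (Sm : ℝ → Z →L[ℝ] Z) (C : Z →L[ℝ] EuclideanSpace ℝ (Fin ny))
    (K Q : Z →L[ℝ] EuclideanSpace ℝ (Fin nu)) (r : EuclideanSpace ℝ (Fin ny)) (v : Z) :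
    EuclideanSpace ℝ (Fin nu) :=
  -K v - Q (refTerm Sm C r)

section Laws

variable (C : Z →L[ℝ] EuclideanSpace ℝ (Fin ny)) (K Q : Z →L[ℝ] EuclideanSpace ℝ (Fin nu))
  (r : EuclideanSpace ℝ (Fin ny))

theorem sdacFeedback_sub_lqtFeedback (hst : IsExpStable Sm) (hSm : IsC0Semigroup Sm)
    (vp vh v : Z) :
    sdacFeedback Sm C K Q r vp vh - lqtFeedback Sm C K Q r v
      = -K (vh - v) + (-(Q.comp (gramianCLM hst hSm C))) vp := by
  simp only [sdacFeedback, lqtFeedback, staticFeedforward, map_add, map_sub, neg_apply,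
    ContinuousLinearMap.comp_apply, gramianCLM_apply]
  abel

theorem sdacFeedback_sub_sub_lqtFeedback (hst : IsExpStable Sm) (hSm : IsC0Semigroup Sm)
    (vp v w : Z) :
    sdacFeedback Sm C K Q r vp (v - vp) - lqtFeedback Sm C K Q r w
      = -K (v - w) + (K - Q.comp (gramianCLM hst hSm C)) vp := by
  rw [sdacFeedback_sub_lqtFeedback C K Q r hst hSm]
  simp only [map_sub, neg_apply, sub_apply]
  abel

theorem continuousOn_lqtFeedback {v : ℝ → Z} (hv : ContinuousOn v (Ici 0)) :
    ContinuousOn (fun t => lqtFeedback Sm C K Q r (v t)) (Ici 0) :=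
  (K.continuous.comp_continuousOn hv).neg.sub continuousOn_const

theorem continuousOn_sdacFeedback (hst : IsExpStable Sm) (hSm : IsC0Semigroup Sm) {vp vh : ℝ → Z}
    (hvp : ContinuousOn vp (Ici 0)) (hvh : ContinuousOn vh (Ici 0)) :
    ContinuousOn (fun t => sdacFeedback Sm C K Q r (vp t) (vh t)) (Ici 0) :=
  (K.continuous.comp_continuousOn hvh).neg.sub <| Q.continuous.comp_continuousOn <|
    ((gramianCLM hst hSm C).continuous.comp_continuousOn hvp).add continuousOn_const

end Laws

theorem IsMildSolution.hasExpDecay_of_zero {v : ℝ → Z} {v₀ : Z}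
    (hv : IsMildSolution Sm (fun _ _ => 0) v₀ v) (hSm : IsC0Semigroup Sm)
    (hM : ∀ t, 0 ≤ t → ‖Sm t‖ ≤ M * Real.exp (-β * t)) : HasExpDecay v (M * ‖v₀‖) β :=
  ⟨hv.1, fun t ht => by
    rw [(isMildSolution_zero_iff.1 hv).2 t ht]
    exact (hSm.hasExpDecay_orbit hM v₀).norm_le t ht⟩

theorem IsMildSolution.hasExpDecay {g e : ℝ → Z} {e₀ : Z} (hSm : IsC0Semigroup Sm) (hβ : 0 < β)
    (hM : ∀ t, 0 ≤ t → ‖Sm t‖ ≤ M * Real.exp (-β * t))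
    (he : IsMildSolution Sm (fun s _ => g s) e₀ e) (hg : HasExpDecay g c β) :
    HasExpDecay e (M * ‖e₀‖ + M * c * (2 / β)) (β / 2) :=
  have hsum := ((hSm.hasExpDecay_orbit hM e₀).mono le_rfl (half_le_self hβ.le)).add
    (hg.convolution hSm.cont hβ hM)
  ⟨he.1, fun t ht => by rw [he.2 t ht]; exact hsum.norm_le t ht⟩

section Signals

variable {B : EuclideanSpace ℝ (Fin nu) →L[ℝ] Z} {K : Z →L[ℝ] EuclideanSpace ℝ (Fin nu)}
  {g : ℝ → EuclideanSpace ℝ (Fin nu)}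
  {u₁ u₂ : ℝ → Z → EuclideanSpace ℝ (Fin nu)} {v₁ v₂ : ℝ → Z} {w₁ w₂ : Z} {a x : ℝ}

theorem IsFeedbackSemigroup.isMildSolution_sub (hK : IsFeedbackSemigroup S Sm B K)
    (hS : IsC0Semigroup S)
    (hv₁ : IsMildSolution S (fun s z => B (u₁ s z)) w₁ v₁)
    (hv₂ : IsMildSolution S (fun s z => B (u₂ s z)) w₂ v₂)
    (hu₁ : ContinuousOn (fun s => u₁ s (v₁ s)) (Ici 0))
    (hu₂ : ContinuousOn (fun s => u₂ s (v₂ s)) (Ici 0))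
    (hg : ContinuousOn g (Ici 0))
    (hsub : ∀ t, u₁ t (v₁ t) - u₂ t (v₂ t) = -K (v₁ t - v₂ t) + g t) :
    IsMildSolution Sm (fun s _ => B (g s)) (w₁ - w₂) (fun t => v₁ t - v₂ t) := by
  refine hK (B.continuous.comp_continuousOn hg) ((hv₁.sub hv₂ hS.cont
    (B.continuous.comp_continuousOn hu₁) (B.continuous.comp_continuousOn hu₂)).congr fun s _ => ?_)
  rw [← map_sub, hsub, map_add, map_neg, neg_add_eq_sub]

theorem IsFeedbackSemigroup.hasExpDecay_control_sub (hK : IsFeedbackSemigroup S Sm B K)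
    (hS : IsC0Semigroup S) (hSm : IsC0Semigroup Sm) (hβ : 0 < β)
    (hM : ∀ t, 0 ≤ t → ‖Sm t‖ ≤ M * Real.exp (-β * t))
    (hv₁ : IsMildSolution S (fun s z => B (u₁ s z)) w₁ v₁)
    (hv₂ : IsMildSolution S (fun s z => B (u₂ s z)) w₂ v₂)
    (hu₁ : ContinuousOn (fun s => u₁ s (v₁ s)) (Ici 0))
    (hu₂ : ContinuousOn (fun s => u₂ s (v₂ s)) (Ici 0))
    (hsub : ∀ t, u₁ t (v₁ t) - u₂ t (v₂ t) = -K (v₁ t - v₂ t) + g t)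
    (hg : HasExpDecay g (a * x) β) (hx : ‖w₁ - w₂‖ ≤ x) :
    HasExpDecay (fun t => u₁ t (v₁ t) - u₂ t (v₂ t))
      (signalAmplitude B K M β a * x) (β / 2) := by
  have hM0 : 0 ≤ M := by simpa using (norm_nonneg _).trans (hM 0 le_rfl)
  have he := (hK.isMildSolution_sub hS hv₁ hv₂ hu₁ hu₂ hg.continuousOn hsub).hasExpDecay hSm hβ hM
    (hg.clm_comp B)
  have hu := (he.clm_comp (-K)).add (hg.mono le_rfl (half_le_self hβ.le))
  simp only [neg_apply, ← hsub, norm_neg] at hu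
  refine hu.mono ?_ le_rfl
  calc ‖K‖ * (M * ‖w₁ - w₂‖ + M * (‖B‖ * (a * x)) * (2 / β)) + a * x
      ≤ ‖K‖ * (M * x + M * (‖B‖ * (a * x)) * (2 / β)) + a * x := by gcongr
    _ = signalAmplitude B K M β a * x := by rw [signalAmplitude]; ring

end Signals

section Tracking

variable {B : EuclideanSpace ℝ (Fin nu) →L[ℝ] Z} {C : Z →L[ℝ] EuclideanSpace ℝ (Fin ny)}
  {K Q : Z →L[ℝ] EuclideanSpace ℝ (Fin nu)} {a x : ℝ} {vp vs : ℝ → Z} {vp₀ vs₀ : Z}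

theorem IsMildSolution.hasExpDecay_clm (hvp : IsMildSolution Sm (fun _ _ => 0) vp₀ vp)
    (hSm : IsC0Semigroup Sm) (hM : ∀ t, 0 ≤ t → ‖Sm t‖ ≤ M * Real.exp (-β * t))
    {G : Z →L[ℝ] EuclideanSpace ℝ (Fin nu)} (hG : ‖G‖ * M ≤ a) (hx : ‖vp₀‖ ≤ x) :
    HasExpDecay (fun t => G (vp t)) (a * x) β := by
  have hM0 : 0 ≤ M := by simpa using (norm_nonneg _).trans (hM 0 le_rfl)
  refine ((hvp.hasExpDecay_of_zero hSm hM).clm_comp G).mono ?_ le_rfl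
  rw [← mul_assoc]
  gcongr
  exact (by positivity : 0 ≤ ‖G‖ * M).trans hG

theorem IsMildSolution.hasExpDecay_law_sub (hst : IsExpStable Sm) (hSm : IsC0Semigroup Sm)
    (hM : ∀ t, 0 ≤ t → ‖Sm t‖ ≤ M * Real.exp (-β * t))
    (ha : ‖K - Q.comp (gramianCLM hst hSm C)‖ * M ≤ a)
    (hvp : IsMildSolution Sm (fun _ _ => 0) vp₀ vp) (r : EuclideanSpace ℝ (Fin ny)) (z : Z) :
    HasExpDecay (fun t => sdacFeedback Sm C K Q r (vp t) (z - vp t) - lqtFeedback Sm C K Q r z)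
      (a * ‖vp₀‖) β := by
  simp only [sdacFeedback_sub_sub_lqtFeedback C K Q r hst hSm, sub_self, map_zero, neg_zero,
    zero_add]
  exact hvp.hasExpDecay_clm hSm hM ha le_rfl

theorem IsFeedbackSemigroup.hasExpDecay_sub_of_homogeneous (hK : IsFeedbackSemigroup S Sm B K)
    (hst : IsExpStable Sm) (hS : IsC0Semigroup S) (hSm : IsC0Semigroup Sm) (hβ : 0 < β)
    (hM : ∀ t, 0 ≤ t → ‖Sm t‖ ≤ M * Real.exp (-β * t))
    (ha : ‖-(Q.comp (gramianCLM hst hSm C))‖ * M ≤ a) {r : EuclideanSpace ℝ (Fin ny)}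
    (hvp : IsMildSolution Sm (fun _ _ => 0) vp₀ vp)
    (hvs : IsMildSolution S (fun _ z => B (lqtFeedback Sm C K Q r z)) vs₀ vs)
    {vh₀ : Z} {vh : ℝ → Z}
    (hvh : IsMildSolution S (fun s z => B (sdacFeedback Sm C K Q r (vp s) z)) vh₀ vh) :
    HasExpDecay (fun t => sdacFeedback Sm C K Q r (vp t) (vh t) - lqtFeedback Sm C K Q r (vs t))
      (signalAmplitude B K M β a * (‖vp₀‖ + ‖vp₀ + vh₀ - vs₀‖)) (β / 2) := by
  refine hK.hasExpDecay_control_sub hS hSm hβ hM hvh hvs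
    (continuousOn_sdacFeedback C K Q r hst hSm hvp.1 hvh.1)
    (continuousOn_lqtFeedback C K Q r hvs.1)
    (fun _ => sdacFeedback_sub_lqtFeedback C K Q r hst hSm _ _ _)
    (hvp.hasExpDecay_clm hSm hM ha (le_add_of_nonneg_right (norm_nonneg _))) ?_
  calc ‖vh₀ - vs₀‖ = ‖vp₀ + vh₀ - vs₀ - vp₀‖ := by congr 1; abel
    _ ≤ ‖vp₀‖ + ‖vp₀ + vh₀ - vs₀‖ := (norm_sub_le _ _).trans_eq (add_comm _ _)

theorem IsFeedbackSemigroup.hasExpDecay_sub_of_plant (hK : IsFeedbackSemigroup S Sm B K)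
    (hst : IsExpStable Sm) (hS : IsC0Semigroup S) (hSm : IsC0Semigroup Sm) (hβ : 0 < β)
    (hM : ∀ t, 0 ≤ t → ‖Sm t‖ ≤ M * Real.exp (-β * t))
    (ha : ‖K - Q.comp (gramianCLM hst hSm C)‖ * M ≤ a) {r : EuclideanSpace ℝ (Fin ny)}
    (hvp : IsMildSolution Sm (fun _ _ => 0) vp₀ vp)
    (hvs : IsMildSolution S (fun _ z => B (lqtFeedback Sm C K Q r z)) vs₀ vs)
    {v₀ : Z} {v : ℝ → Z}
    (hv : IsMildSolution S (fun s z => B (sdacFeedback Sm C K Q r (vp s) (z - vp s))) v₀ v) :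
    HasExpDecay
      (fun t => sdacFeedback Sm C K Q r (vp t) (v t - vp t) - lqtFeedback Sm C K Q r (vs t))
      (signalAmplitude B K M β a * (‖vp₀‖ + ‖v₀ - vs₀‖)) (β / 2) :=
  hK.hasExpDecay_control_sub (u₁ := fun s z => sdacFeedback Sm C K Q r (vp s) (z - vp s))
    hS hSm hβ hM hv hvs
    (continuousOn_sdacFeedback C K Q r hst hSm hvp.1 (hv.1.sub hvp.1))
    (continuousOn_lqtFeedback C K Q r hvs.1)
    (fun _ => sdacFeedback_sub_sub_lqtFeedback C K Q r hst hSm _ _ _)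
    (hvp.hasExpDecay_clm hSm hM ha (le_add_of_nonneg_right (norm_nonneg _)))
    (le_add_of_nonneg_left (norm_nonneg _))

end Tracking

end Control

end SDAC

theorem lemma4_general {Z : Type*} [NormedAddCommGroup Z] [InnerProductSpace ℝ Z] [CompleteSpace Z]
    {nu ny : ℕ}
    (A : Z →ₗ.[ℝ] Z) (S : ℝ → Z →L[ℝ] Z) (hA : SDAC.Generates A S)
    (B : EuclideanSpace ℝ (Fin nu) →L[ℝ] Z) (C : Z →L[ℝ] EuclideanSpace ℝ (Fin ny))
    (K Q : Z →L[ℝ] EuclideanSpace ℝ (Fin nu))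
    (hLyap : SDAC.HasCoerciveLyapunov (SDAC.closedLoop A B K)) :
    ∃ Sm : ℝ → Z →L[ℝ] Z,
      SDAC.Generates (SDAC.closedLoop A B K) Sm ∧
      SDAC.IsExpStable Sm ∧
      (∀ z : Z, IntegrableOn (SDAC.gramianIntegrand Sm C z) (Ioi 0)) ∧
      (∀ r : EuclideanSpace ℝ (Fin ny), IntegrableOn
        (fun τ : ℝ => SDAC.adjSemigroup Sm τ (ContinuousLinearMap.adjoint C r)) (Ioi 0)) ∧
      ∃ M β : ℝ, 0 < M ∧ 0 < β ∧
        ∀ (r : EuclideanSpace ℝ (Fin ny)) (vp₀ : Z) (vp : ℝ → Z),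
          SDAC.IsMildSolution Sm (fun _ _ => 0) vp₀ vp →
          (∀ t : ℝ, 0 ≤ t →
            Tendsto (fun T : ℝ => SDAC.costate Sm C (fun s => r - C (vp s)) T t) atTop
              (𝓝 (SDAC.staticFeedforward Sm C r (vp t)))) ∧
          (∀ t : ℝ, 0 ≤ t → ∀ z : Z,
            ‖SDAC.sdacFeedback Sm C K Q r (vp t) (z - vp t) - SDAC.lqtFeedback Sm C K Q r z‖
              ≤ M * Real.exp (-β * t) * ‖vp₀‖) ∧
          (∀ z : Z, MemLp
            (fun t : ℝ =>
              SDAC.sdacFeedback Sm C K Q r (vp t) (z - vp t) - SDAC.lqtFeedback Sm C K Q r z)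
            ⊤ (volume.restrict (Ici 0))) ∧
          (∀ (vs₀ : Z) (vs : ℝ → Z),
            SDAC.IsMildSolution S (fun _ z => B (SDAC.lqtFeedback Sm C K Q r z)) vs₀ vs →
            (∀ (vh₀ : Z) (vh : ℝ → Z),
              SDAC.IsMildSolution S (fun s z => B (SDAC.sdacFeedback Sm C K Q r (vp s) z)) vh₀ vh →
              (∀ t : ℝ, 0 ≤ t →
                ‖SDAC.sdacFeedback Sm C K Q r (vp t) (vh t) - SDAC.lqtFeedback Sm C K Q r (vs t)‖
                  ≤ M * Real.exp (-β * t) * (‖vp₀‖ + ‖vp₀ + vh₀ - vs₀‖)) ∧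
              MemLp
                (fun t : ℝ =>
                  SDAC.sdacFeedback Sm C K Q r (vp t) (vh t) - SDAC.lqtFeedback Sm C K Q r (vs t))
                ⊤ (volume.restrict (Ici 0))) ∧
            (∀ (v₀ : Z) (v : ℝ → Z),
              SDAC.IsMildSolution S
                (fun s z => B (SDAC.sdacFeedback Sm C K Q r (vp s) (z - vp s))) v₀ v →
              (∀ t : ℝ, 0 ≤ t →
                ‖SDAC.sdacFeedback Sm C K Q r (vp t) (v t - vp t)
                    - SDAC.lqtFeedback Sm C K Q r (vs t)‖
                  ≤ M * Real.exp (-β * t) * (‖vp₀‖ + ‖v₀ - vs₀‖)) ∧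
              MemLp
                (fun t : ℝ => SDAC.sdacFeedback Sm C K Q r (vp t) (v t - vp t)
                  - SDAC.lqtFeedback Sm C K Q r (vs t))
                ⊤ (volume.restrict (Ici 0)))) := by
  obtain ⟨Sm, hgen, hK⟩ := hA.exists_closedLoop B K
  have hst := hgen.isExpStable hLyap
  refine ⟨Sm, hgen, hst, hst.integrableOn_gramianIntegrand hgen.1 C,
    fun r => hst.integrableOn_adjSemigroup hgen.1 _, ?_⟩
  obtain ⟨M, β, hM0, hβ, hM⟩ := id hst
  set F := Q.comp (SDAC.gramianCLM hst hgen.1 C)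
  obtain ⟨a, ha, haF, haKF⟩ : ∃ a, 0 < a ∧ ‖-F‖ * M ≤ a ∧ ‖K - F‖ * M ≤ a :=
    ⟨‖-F‖ * M + ‖K - F‖ * M + 1, by positivity, by nlinarith [norm_nonneg (K - F)],
      by nlinarith [norm_nonneg (-F)]⟩
  have hamp := SDAC.le_signalAmplitude B K hM0.le hβ.le ha.le
  refine ⟨SDAC.signalAmplitude B K M β a, β / 2, ha.trans_le hamp, half_pos hβ,
    fun r vp₀ vp hvp => ?_⟩
  have hlaw := fun z => (hvp.hasExpDecay_law_sub hst hgen.1 hM haKF r z).mono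
    (mul_le_mul_of_nonneg_right hamp (norm_nonneg _)) (half_le_self hβ.le)
  refine ⟨fun t ht => hst.tendsto_costate hgen.1 C r (SDAC.isMildSolution_zero_iff.1 hvp).2 ht,
    fun t ht z => (hlaw z).norm_le_mul t ht, fun z => (hlaw z).memLp_top (half_pos hβ).le,
    fun vs₀ vs hvs => ⟨fun vh₀ vh hvh => ?_, fun v₀ v hv => ?_⟩⟩
  · have hsignal := hK.hasExpDecay_sub_of_homogeneous hst hA.1 hgen.1 hβ hM haF hvp hvs hvh
    exact ⟨hsignal.norm_le_mul, hsignal.memLp_top (half_pos hβ).le⟩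
  · have hsignal := hK.hasExpDecay_sub_of_plant hst hA.1 hgen.1 hβ hM haKF hvp hvs hv
    exact ⟨hsignal.norm_le_mul, hsignal.memLp_top (half_pos hβ).le⟩

theorem lemma4 {Z : Type*} [NormedAddCommGroup Z] [InnerProductSpace ℝ Z] [CompleteSpace Z]
    {nu ny : ℕ}
    (A : Z →ₗ.[ℝ] Z) (S : ℝ → Z →L[ℝ] Z) (hA : SDAC.Generates A S)
    (B : EuclideanSpace ℝ (Fin nu) →L[ℝ] Z) (C : Z →L[ℝ] EuclideanSpace ℝ (Fin ny))
    (R : Matrix (Fin nu) (Fin nu) ℝ) (hR : R.PosDef)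
    (X : Z →L[ℝ] Z) (hX : SDAC.SolvesRiccati A B C R X)
    (hLyap : SDAC.HasCoerciveLyapunov (SDAC.closedLoop A B (SDAC.gain B R X))) :
    ∃ Sm : ℝ → Z →L[ℝ] Z,
      -- `A_m = A - B K` generates an exponentially stable semigroup `Sm`
      SDAC.Generates (SDAC.closedLoop A B (SDAC.gain B R X)) Sm ∧
      SDAC.IsExpStable Sm ∧
      -- the integrals that define `W_o` and `(A_m*)⁻¹ C* r` exist
      (∀ z : Z, IntegrableOn (SDAC.gramianIntegrand Sm C z) (Ioi 0)) ∧
      (∀ r : EuclideanSpace ℝ (Fin ny), IntegrableOn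
        (fun τ : ℝ => SDAC.adjSemigroup Sm τ (ContinuousLinearMap.adjoint C r)) (Ioi 0)) ∧
      ∃ M β : ℝ, 0 < M ∧ 0 < β ∧
        ∀ (r : EuclideanSpace ℝ (Fin ny)) (vp₀ : Z) (vp : ℝ → Z),
          -- the particular half `v_p' = A_m v_p`
          SDAC.IsMildSolution Sm (fun _ _ => 0) vp₀ vp →
          -- the static feedforward is the infinite-horizon limit of the costate
          (∀ t : ℝ, 0 ≤ t →
            Tendsto (fun T : ℝ => SDAC.costate Sm C (fun s => r - C (vp s)) T t) atTop
              (𝓝 (SDAC.staticFeedforward Sm C r (vp t)))) ∧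
          -- as maps of the state `z = v_p + v_h`, the laws converge exponentially fast
          (∀ t : ℝ, 0 ≤ t → ∀ z : Z,
            ‖SDAC.sdacLaw Sm B C R X r (vp t) (z - vp t) - SDAC.lqtLaw Sm B C R X r z‖
              ≤ M * Real.exp (-β * t) * ‖vp₀‖) ∧
          (∀ z : Z, MemLp
            (fun t : ℝ =>
              SDAC.sdacLaw Sm B C R X r (vp t) (z - vp t) - SDAC.lqtLaw Sm B C R X r z)
            ⊤ (volume.restrict (Ici 0))) ∧
          -- the control signals, compared along the LQT trajectory `v⋆' = A v⋆ + B u_lqt(v⋆)`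
          (∀ (vs₀ : Z) (vs : ℝ → Z),
            SDAC.IsMildSolution S (fun _ z => B (SDAC.lqtLaw Sm B C R X r z)) vs₀ vs →
            -- with the homogeneous half `v_h' = A v_h + B u`, `u` the SDAC law
            (∀ (vh₀ : Z) (vh : ℝ → Z),
              SDAC.IsMildSolution S (fun s z => B (SDAC.sdacLaw Sm B C R X r (vp s) z)) vh₀ vh →
              (∀ t : ℝ, 0 ≤ t →
                ‖SDAC.sdacLaw Sm B C R X r (vp t) (vh t) - SDAC.lqtLaw Sm B C R X r (vs t)‖
                  ≤ M * Real.exp (-β * t) * (‖vp₀‖ + ‖vp₀ + vh₀ - vs₀‖)) ∧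
              MemLp
                (fun t : ℝ =>
                  SDAC.sdacLaw Sm B C R X r (vp t) (vh t) - SDAC.lqtLaw Sm B C R X r (vs t))
                ⊤ (volume.restrict (Ici 0))) ∧
            -- with the plant `v' = A v + B u`, `u` the SDAC law with `v_h = v - v_p`
            (∀ (v₀ : Z) (v : ℝ → Z),
              SDAC.IsMildSolution S
                (fun s z => B (SDAC.sdacLaw Sm B C R X r (vp s) (z - vp s))) v₀ v →
              (∀ t : ℝ, 0 ≤ t →
                ‖SDAC.sdacLaw Sm B C R X r (vp t) (v t - vp t) - SDAC.lqtLaw Sm B C R X r (vs t)‖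
                  ≤ M * Real.exp (-β * t) * (‖vp₀‖ + ‖v₀ - vs₀‖)) ∧
              MemLp
                (fun t : ℝ =>
                  SDAC.sdacLaw Sm B C R X r (vp t) (v t - vp t) - SDAC.lqtLaw Sm B C R X r (vs t))
                ⊤ (volume.restrict (Ici 0)))) :=
  lemma4_general A S hA B C (SDAC.gain B R X) (SDAC.RinvBadj B R) hLyap
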